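/- **Conventions.** Manifolds are smooth, Hausdorff, second countable, finite dimensional (of constant dimension) and without boundary. In a Lie groupoid with source $s$, target $t$ and unit $\epsilon$, the product $xy$ is defined when $t(x)=s(y)$. For a Lie groupoid $\mathcal G\rightrightarrows M$ and a surjective submersion $p:M'\to M$, the pull-back $\mathcal G[p]=M'\times_{p,M,s}\mathcal G\times_{t,M,p}M'\rightrightarrows M'$ is the Lie groupoid with source and target the outer projections and product $(x,\gamma,y)(y,\gamma',z)=(x,\gamma\gamma',z)$; we identify $\mathcal G[p][r]$ with $\mathcal G[p\circ r]$. Let $\mathbf G\xrightarrow{\rho}\mathbf H$ be a crossed module of finite dimensional Lie groups: $\rho$ is a Lie group morphism and $\mathbf H$ acts smoothly on $\mathbf G$ by automorphisms, $(h,g)\mapsto h(g)$, with $\rho(h(g))=h\rho(g)h^{-1}$ and $\rho(g)(g')=gg'g^{-1}$. **Extensions.** A $\mathbf G\to\mathbf H$-extension of $\mathcal G\rightrightarrows M$ is a triple $(\mathcal R\xrightarrow{\varphi}\mathcal G,\ P\xrightarrow{\pi}M,\ \chi)$ where 1. $\varphi$ is a morphism of Lie groupoids over $\mathrm{id}_M$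 which is a surjective submersion and whose kernel $K=\varphi^{-1}(\epsilon(M))$ is a locally trivial bundle of Lie groups over $M$ with typical fibre $\mathbf G$; 2. $P$ is a (right) principal $\mathbf H$-bundle over $M$ with a smooth left action of $\mathcal R$ on $\pi$ (that is, $r\cdot p$ is defined when $t(r)=\pi(p)$, and $\pi(r\cdot p)=s(r)$) which commutes with the action of $\mathbf H$; 3. $\chi$ assigns to $p\in P$ a Lie group isomorphism $\chi(p):\mathbf G\to K_{\pi(p)}=\varphi^{-1}(\epsilon(\pi(p)))$, smoothly in $p$, such that $\chi(r\cdot p\cdot h)(g)=r\,\chi(p)(h(g))\,r^{-1}$ and $p\cdot\rho(g)=\chi(p)(g)\cdot p$ for all $g\in\mathbf G$, $h\in\mathbf H$, $p\in P$, $r\in\mathcal R$ with $t(r)=\pi(p)$. An isomorphism of two $\mathbf G\to\mathbf H$-extensions $(\mathcal R\xrightarrow{\varphi}\mathcal G,P,\chi)$ and $(\mathcal R'\xrightarrow{\varphi'}\mathcal G,P',\chi')$ of $\mathcal G$ is a pair of a Lie groupoid isomorphism $\Phi:\mathcal R\to\mathcal R'$ over $\mathrm{id}_M$ with $\varphi'\circ\Phi=\varphi$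 and a diffeomorphism $\Psi:P\to P'$ over $\mathrm{id}_M$ with $\Psi(r\cdot p\cdot h)=\Phi(r)\cdot\Psi(p)\cdot h$ and $\chi'(\Psi(p))=\Phi\circ\chi(p)$. The pull-back along a surjective submersion $p:M'\to M$ is the extension $(\mathcal R[p]\xrightarrow{\varphi[p]}\mathcal G[p],\ P\times_M M'\to M',\ \chi[p])$ of $\mathcal G[p]$, with $\varphi[p](x,r,y)=(x,\varphi(r),y)$, action $(n,r,n')\cdot(x,n')=(r\cdot x,n)$ and $\chi[p](x,n)(g)=(n,\chi(x)(g),n)$. **Gerbes.** A $\mathbf G\to\mathbf H$-extension over a Lie groupoid $B\rightrightarrows B_0$ consists of a surjective submersion $q:M\to B_0$ and a $\mathbf G\to\mathbf H$-extension of $B[q]\rightrightarrows M$. Its pull-back along a surjective submersion $p:M'\to M$ is the pulled back extension of $B[q][p]=B[q\circ p]$, together with $q\circ p$. Two extensions over $B$, with base maps $q:M\to B_0$ and $q':M'\to B_0$, are Morita equivalent if there are a manifold $M''$ and surjective submersions $p:M''\to M$, $p':M''\to M'$ with $q\circ p=q'\circ p'$ such that the pull-backs along $p$ and $p'$ are isomorphic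 extensions of $B[q\circ p]=B[q'\circ p']$. A $\mathbf G\to\mathbf H$-gerbe over $B\rightrightarrows B_0$ is a Morita equivalence class of $\mathbf G\to\mathbf H$-extensions over $B$. **Theorem.** Let $\mathcal M=(T,f,g,\Phi)$ be a Morita equivalence between Lie groupoids $B\rightrightarrows B_0$ and $B'\rightrightarrows B'_0$, that is, a manifold $T$, surjective submersions $f:T\to B_0$ and $g:T\to B_0'$, and an isomorphism of Lie groupoids $\Phi:B[f]\to B'[g]$ over $\mathrm{id}_T$. To an extension $E=(q,\mathcal R\xrightarrow{\varphi}B[q],P\to M,\chi)$ over $B$ associate the extension $$\mathcal M_*E=\bigl(g\circ\beta,\ \mathcal R[\alpha]\xrightarrow{\Phi'\circ\varphi[\alpha]}B'[g\circ\beta],\ P\times_M M_T\to M_T,\ \chi[\alpha]\bigr)$$ over $B'$, where $M_T=M\times_{q,B_0,f}T$ has projections $\alpha:M_T\to M$ and $\beta:M_T\to T$, and $\Phi':B[q\circ\alpha]\to B'[g\circ\beta]$ maps $(x,b,y)$ to $(x,b',y)$ with $\Phi(\beta(x),b,\beta(y))=(\beta(x),b',\beta(y))$. Then $[E]\mapsto[\mathcal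 M_*E]$ is a well-defined bijection from the $\mathbf G\to\mathbf H$-gerbes over $B\rightrightarrows B_0$ to the $\mathbf G\to\mathbf H$-gerbes over $B'\rightrightarrows B_0'$. Its inverse is the map $[E']\mapsto[(\mathcal M^{-1})_*E']$ induced by the inverse Morita equivalence $\mathcal M^{-1}=(T,g,f,\Phi^{-1})$. -/

import Mathlib

open Set Filter Topology
open scoped Manifold ContDiff

universe u

/-- A smooth manifold: Hausdorff, second countable, without boundary, of constant finite
dimension `dim`. -/
structure Mfd : Type (u + 1) where
  carrier : Type u
  dim : ℕ
  [top : TopologicalSpace carrier]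
  [charted : ChartedSpace (EuclideanSpace ℝ (Fin dim)) carrier]
  [smooth : IsManifold (𝓡 dim) ∞ carrier]
  [t2 : T2Space carrier]
  [sc : SecondCountableTopology carrier]

namespace Mfd

instance : CoeSort Mfd.{u} (Type u) := ⟨Mfd.carrier⟩

attribute [instance] Mfd.top Mfd.charted Mfd.smooth Mfd.t2 Mfd.sc

/-- Smooth (`C^∞`) maps between manifolds. -/
abbrev Smooth {M N : Mfd.{u}} (f : M → N) : Prop := ContMDiff (𝓡 M.dim) (𝓡 N.dim) ∞ f

/-- Smoothness at a point. -/
abbrev SmoothAt {M N : Mfd.{u}} (f : M → N) (x : M) : Prop :=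
  ContMDiffAt (𝓡 M.dim) (𝓡 N.dim) ∞ f x

/-- Submersions between manifolds. -/
abbrev Subm {M N : Mfd.{u}} (f : M → N) : Prop :=
  Manifold.IsSubmersion (𝓡 M.dim) (𝓡 N.dim) ∞ f

/-- Surjective submersions between manifolds. -/
structure SurjSubm {M N : Mfd.{u}} (f : M → N) : Prop where
  subm : Subm f
  surj : Function.Surjective f

end Mfd

open Mfd

/-- The set-theoretic fibre product of the maps `f` and `g`. For manifolds it is given the topology
induced from the product. -/
@[ext]
structure FPSet {X Y Z : Type u} (f : X → Z) (g : Y → Z) : Type u where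
  fst : X
  snd : Y
  eq : f fst = g snd

namespace FPSet

variable {M N P : Mfd.{u}} {f : M → P} {g : N → P}

/-- The inclusion of the fibre product in the product. -/
def toProd (z : FPSet f g) : M × N := (z.fst, z.snd)

instance : TopologicalSpace (FPSet f g) := TopologicalSpace.induced toProd inferInstance

theorem isEmbedding_toProd : IsEmbedding (toProd : FPSet f g → M × N) :=
  ⟨⟨rfl⟩, fun _ _ h => FPSet.ext (congrArg Prod.fst h) (congrArg Prod.snd h)⟩

instance : T2Space (FPSet f g) := isEmbedding_toProd.t2Space
instance : SecondCountableTopology (FPSet f g) :=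
  isEmbedding_toProd.isInducing.secondCountableTopology

theorem continuous_fst : Continuous fun z : FPSet f g => z.fst :=
  _root_.continuous_fst.comp isEmbedding_toProd.continuous
theorem continuous_snd : Continuous fun z : FPSet f g => z.snd :=
  _root_.continuous_snd.comp isEmbedding_toProd.continuous

/-- The dimension of the fibre product of `f : M → P` and `g : N → P`. -/
def fdim (M N P : Mfd.{u}) : ℕ := (M.dim - P.dim) + N.dim

/-- Auxiliary data at a point `z` of the fibre product of a submersion `f` with a smooth map `g`:
charts in which `f` is the projection `(u, v) ↦ u`, a chart of `N` and an identification of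
model spaces. -/
structure Pre (f : M → P) (g : N → P) (z : FPSet f g) where
  F : Type
  [i1 : NormedAddCommGroup F]
  [i2 : NormedSpace ℝ F]
  φ : OpenPartialHomeomorph M (EuclideanSpace ℝ (Fin M.dim))
  ψ : OpenPartialHomeomorph P (EuclideanSpace ℝ (Fin P.dim))
  η : OpenPartialHomeomorph N (EuclideanSpace ℝ (Fin N.dim))
  hφ : φ ∈ IsManifold.maximalAtlas (𝓡 M.dim) ∞ M
  hψ : ψ ∈ IsManifold.maximalAtlas (𝓡 P.dim) ∞ P
  hη : η ∈ IsManifold.maximalAtlas (𝓡 N.dim) ∞ N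
  mφ : z.fst ∈ φ.source
  mη : z.snd ∈ η.source
  sub : φ.source ⊆ f ⁻¹' ψ.source
  e : EuclideanSpace ℝ (Fin M.dim) ≃L[ℝ] (EuclideanSpace ℝ (Fin P.dim) × F)
  L : EuclideanSpace ℝ (Fin (fdim M N P)) ≃L[ℝ] (F × EuclideanSpace ℝ (Fin N.dim))
  he : ∀ w ∈ φ.target, ψ (f (φ.symm w)) = (e w).1

attribute [instance] Pre.i1 Pre.i2

theorem exists_pre (hf : Subm f) (z : FPSet f g) : Nonempty (Pre f g z) := by
  obtain ⟨F, i1, i2, h⟩ := hf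
  have h := h z.fst
  have hfd : FiniteDimensional ℝ (EuclideanSpace ℝ (Fin P.dim) × F) :=
    LinearEquiv.finiteDimensional h.equiv.toLinearEquiv
  have hF : FiniteDimensional ℝ F :=
    Module.Finite.of_surjective (LinearMap.snd ℝ (EuclideanSpace ℝ (Fin P.dim)) F)
      Prod.snd_surjective
  have hr : Module.finrank ℝ F = M.dim - P.dim := by
    have := h.equiv.toLinearEquiv.finrank_eq
    rw [Module.finrank_prod] at this
    simp at this
    omega
  refine ⟨{ F := F, φ := h.domChart, ψ := h.codChart, η := chartAt _ z.snd
            hφ := h.domChart_mem_maximalAtlas, hψ := h.codChart_mem_maximalAtlas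
            hη := IsManifold.chart_mem_maximalAtlas _
            mφ := h.mem_domChart_source, mη := mem_chart_source _ _
            sub := h.source_subset_preimage_source
            e := h.equiv
            L := ContinuousLinearEquiv.ofFinrankEq ?_
            he := ?_ }⟩
  · rw [Module.finrank_prod, hr, finrank_euclideanSpace_fin, finrank_euclideanSpace_fin]; rfl
  · intro w hw
    have hw' : w ∈ (h.domChart.extend (𝓡 M.dim)).target := by simpa using hw
    have := h.writtenInCharts hw'
    simpa using this

namespace Pre

variable {z : FPSet f g} (p : Pre f g z)

/-- The inverse chart, first component. -/
def a (w : EuclideanSpace ℝ (Fin (fdim M N P))) : M :=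
  p.φ.symm (p.e.symm (p.ψ (g (p.η.symm (p.L w).2)), (p.L w).1))

/-- The inverse chart, second component. -/
def b (w : EuclideanSpace ℝ (Fin (fdim M N P))) : N := p.η.symm (p.L w).2

/-- The image of the chart. -/
def tgt : Set (EuclideanSpace ℝ (Fin (fdim M N P))) :=
  {w | ((p.L w).2 ∈ p.η.target ∧ g (p.η.symm (p.L w).2) ∈ p.ψ.source) ∧
    p.e.symm (p.ψ (g (p.η.symm (p.L w).2)), (p.L w).1) ∈ p.φ.target}

theorem eq_of_mem {w} (hw : w ∈ p.tgt) : f (p.a w) = g (p.b w) := by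
  have h := p.he _ hw.2
  simp only [ContinuousLinearEquiv.apply_symm_apply] at h
  exact p.ψ.injOn (p.sub (p.φ.map_target hw.2)) hw.1.2 h

theorem tgt_aux (hg : Smooth g) : IsOpen {w | (p.L w).2 ∈ p.η.target ∧ g (p.η.symm (p.L w).2) ∈ p.ψ.source} ∧
    ContMDiffOn (𝓡 (fdim M N P)) (𝓡 N.dim) ∞ p.b
      {w | (p.L w).2 ∈ p.η.target ∧ g (p.η.symm (p.L w).2) ∈ p.ψ.source} ∧
    ContMDiffOn (𝓡 (fdim M N P)) (𝓡 M.dim) ∞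
      (fun w => p.e.symm (p.ψ (g (p.η.symm (p.L w).2)), (p.L w).1))
      {w | (p.L w).2 ∈ p.η.target ∧ g (p.η.symm (p.L w).2) ∈ p.ψ.source} := by
  have h2 : ContMDiff (𝓡 (fdim M N P)) (𝓡 N.dim) ∞ fun w => (p.L w).2 :=
    (contDiff_snd.comp p.L.contDiff).contMDiff
  have h1 : ContMDiff (𝓡 (fdim M N P)) 𝓘(ℝ, p.F) ∞ fun w => (p.L w).1 :=
    (contDiff_fst.comp p.L.contDiff).contMDiff
  have o1 : IsOpen {w | (p.L w).2 ∈ p.η.target} := p.η.open_target.preimage h2.continuous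
  have hb : ContMDiffOn (𝓡 (fdim M N P)) (𝓡 N.dim) ∞ p.b {w | (p.L w).2 ∈ p.η.target} :=
    (contMDiffOn_symm_of_mem_maximalAtlas p.hη).comp h2.contMDiffOn fun w hw => hw
  have hgb := hg.comp_contMDiffOn hb
  refine ⟨hgb.continuousOn.isOpen_inter_preimage o1 p.ψ.open_source,
    hb.mono fun w hw => hw.1, ?_⟩
  have hψ := (contMDiffOn_of_mem_maximalAtlas p.hψ).comp (hgb.mono fun w (hw : w ∈
    {w | (p.L w).2 ∈ p.η.target ∧ g (p.η.symm (p.L w).2) ∈ p.ψ.source}) => hw.1) fun w hw => hw.2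
  exact p.e.symm.contDiff.contMDiff.comp_contMDiffOn (hψ.prodMk_space h1.contMDiffOn)

theorem isOpen_tgt (hg : Smooth g) : IsOpen p.tgt :=
  (p.tgt_aux hg).2.2.continuousOn.isOpen_inter_preimage (p.tgt_aux hg).1 p.φ.open_target

theorem contMDiffOn_b (hg : Smooth g) : ContMDiffOn (𝓡 (fdim M N P)) (𝓡 N.dim) ∞ p.b p.tgt :=
  (p.tgt_aux hg).2.1.mono fun _ hw => hw.1

theorem contMDiffOn_a (hg : Smooth g) : ContMDiffOn (𝓡 (fdim M N P)) (𝓡 M.dim) ∞ p.a p.tgt :=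
  (contMDiffOn_symm_of_mem_maximalAtlas p.hφ).comp
    ((p.tgt_aux hg).2.2.mono fun _ hw => hw.1) fun _ hw => hw.2

theorem left_inv_aux {y : FPSet f g} (h1 : y.fst ∈ p.φ.source) (_ : y.snd ∈ p.η.source) :
    p.e.symm (p.ψ (g y.snd), (p.e (p.φ y.fst)).2) = p.φ y.fst := by
  rw [← y.eq, ContinuousLinearEquiv.symm_apply_eq]
  have h := p.he _ (p.φ.map_source h1)
  rw [p.φ.left_inv h1] at h
  rw [h]

open Classical in
/-- The chart of the fibre product associated with `p`. -/
noncomputable def chart (hg : Smooth g) : OpenPartialHomeomorph (FPSet f g)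
    (EuclideanSpace ℝ (Fin (fdim M N P))) where
  toFun y := p.L.symm ((p.e (p.φ y.fst)).2, p.η y.snd)
  invFun w := if h : w ∈ p.tgt then ⟨p.a w, p.b w, p.eq_of_mem h⟩ else z
  source := {y | y.fst ∈ p.φ.source ∧ y.snd ∈ p.η.source}
  target := p.tgt
  map_source' y hy := by
    have h := p.left_inv_aux hy.1 hy.2
    refine ⟨⟨?_, ?_⟩, ?_⟩
    · simpa using p.η.map_source hy.2
    · simpa [hy.2, ← y.eq] using p.sub hy.1
    · simpa [hy.2, h] using p.φ.map_source hy.1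
  map_target' w hw := by
    rw [dif_pos hw]
    exact ⟨p.φ.map_target hw.2, p.η.map_target hw.1.1⟩
  left_inv' y hy := by
    have h := p.left_inv_aux hy.1 hy.2
    have hm : p.L.symm ((p.e (p.φ y.fst)).2, p.η y.snd) ∈ p.tgt := by
      refine ⟨⟨?_, ?_⟩, ?_⟩
      · simpa using p.η.map_source hy.2
      · simpa [hy.2, ← y.eq] using p.sub hy.1
      · simpa [hy.2, h] using p.φ.map_source hy.1
    rw [dif_pos hm]
    apply FPSet.ext
    · simp [a, hy.2, h, hy.1]
    · simp [b, hy.2]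
  right_inv' w hw := by
    rw [dif_pos hw]
    simp [a, b, p.φ.right_inv hw.2, p.η.right_inv hw.1.1]
  open_source := (p.φ.open_source.preimage continuous_fst).inter
    (p.η.open_source.preimage continuous_snd)
  open_target := p.isOpen_tgt hg
  continuousOn_toFun := by
    apply p.L.symm.continuous.comp_continuousOn
    refine (_root_.continuous_snd.comp_continuousOn (p.e.continuous.comp_continuousOn
      (p.φ.continuousOn.comp continuous_fst.continuousOn fun y hy => hy.1))).prodMk
      (p.η.continuousOn.comp continuous_snd.continuousOn fun y hy => hy.2)
  continuousOn_invFun := by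
    have : ContinuousOn (fun w => (p.a w, p.b w)) p.tgt :=
      (p.contMDiffOn_a hg).continuousOn.prodMk (p.contMDiffOn_b hg).continuousOn
    refine isEmbedding_toProd.isInducing.continuousOn_iff.2 (this.congr fun w hw => ?_)
    simp [hw, toProd]

theorem chart_symm_fst (hg : Smooth g) {w} (hw : w ∈ p.tgt) : ((p.chart hg).symm w).fst = p.a w :=
  congrArg FPSet.fst (dif_pos hw)

theorem chart_symm_snd (hg : Smooth g) {w} (hw : w ∈ p.tgt) : ((p.chart hg).symm w).snd = p.b w :=
  congrArg FPSet.snd (dif_pos hw)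

/-- Maps with smooth components are smooth when read in the chart. -/
theorem contMDiffOn_chart_comp {E H X : Type*} [NormedAddCommGroup E] [NormedSpace ℝ E]
    [TopologicalSpace H] {I : ModelWithCorners ℝ E H} [TopologicalSpace X] [ChartedSpace H X]
    {a' : X → M} {b' : X → N} {s : Set X}
    (ha : ContMDiffOn I (𝓡 M.dim) ∞ a' s) (hb : ContMDiffOn I (𝓡 N.dim) ∞ b' s)
    (h1 : ∀ x ∈ s, a' x ∈ p.φ.source) (h2 : ∀ x ∈ s, b' x ∈ p.η.source) :
    ContMDiffOn I (𝓡 (fdim M N P)) ∞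
      (fun x => p.L.symm ((p.e (p.φ (a' x))).2, p.η (b' x))) s := by
  have k1 := (contMDiffOn_of_mem_maximalAtlas p.hφ).comp ha h1
  have k2 := (contMDiffOn_of_mem_maximalAtlas p.hη).comp hb h2
  have k3 := (contDiff_snd.comp p.e.contDiff).contMDiff.comp_contMDiffOn k1
  exact p.L.symm.contDiff.contMDiff.comp_contMDiffOn (k3.prodMk_space k2)

end Pre

section
variable (hf : Subm f) (hg : Smooth g)

/-- The chosen chart of the fibre product at `z`. -/
noncomputable def chartAtPt (z : FPSet f g) : OpenPartialHomeomorph (FPSet f g)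
    (EuclideanSpace ℝ (Fin (fdim M N P))) :=
  (exists_pre (g := g) hf z).some.chart hg

/-- The charts of the fibre product of a submersion and a smooth map. -/
@[reducible] noncomputable def chartedSpace :
    ChartedSpace (EuclideanSpace ℝ (Fin (fdim M N P))) (FPSet f g) where
  atlas := range (chartAtPt hf hg)
  chartAt := chartAtPt hf hg
  mem_chart_source z := ⟨(exists_pre (g := g) hf z).some.mφ, (exists_pre (g := g) hf z).some.mη⟩
  chart_mem_atlas z := mem_range_self z

theorem isManifold : @IsManifold ℝ _ _ _ _ _ _ (𝓡 (fdim M N P)) ∞ (FPSet f g) _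
    (chartedSpace hf hg) := by
  let := chartedSpace hf hg
  apply isManifold_of_contDiffOn
  rintro _ _ ⟨z, rfl⟩ ⟨z', rfl⟩
  set p := (exists_pre (g := g) hf z).some with hp
  set p' := (exists_pre (g := g) hf z').some with hp'
  have hz : chartAtPt hf hg z = p.chart hg := rfl
  have hz' : chartAtPt hf hg z' = p'.chart hg := rfl
  rw [hz, hz']
  simp only [modelWithCornersSelf_coe, modelWithCornersSelf_coe_symm, Set.range_id,
    Set.preimage_id_eq, id, Set.inter_univ, Function.comp_id, Function.id_comp]
  rw [← contMDiffOn_iff_contDiffOn]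
  set S := ((p.chart hg).symm ≫ₕ p'.chart hg).source with hS
  have hS1 : ∀ w ∈ S, w ∈ p.tgt := fun w hw => by
    have := hw.1
    exact this
  have hS2 : ∀ w ∈ S, p.a w ∈ p'.φ.source ∧ p.b w ∈ p'.η.source := fun w hw => by
    have h2 : ((p.chart hg).symm w).fst ∈ p'.φ.source ∧
      ((p.chart hg).symm w).snd ∈ p'.η.source := hw.2
    rwa [p.chart_symm_fst hg (hS1 w hw), p.chart_symm_snd hg (hS1 w hw)] at h2
  refine (p'.contMDiffOn_chart_comp ((p.contMDiffOn_a hg).mono hS1)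
    ((p.contMDiffOn_b hg).mono hS1) (fun w hw => (hS2 w hw).1) (fun w hw => (hS2 w hw).2)).congr ?_
  intro w hw
  change p'.L.symm ((p'.e (p'.φ ((p.chart hg).symm w).fst)).2,
    p'.η ((p.chart hg).symm w).snd) = _
  rw [p.chart_symm_fst hg (hS1 w hw), p.chart_symm_snd hg (hS1 w hw)]

end

end FPSet

/-- The fibre product of a submersion `f` and a smooth map `g`, as a manifold. -/
noncomputable def FP {M N P : Mfd.{u}} (f : M → P) (g : N → P) (hf : Subm f) (hg : Smooth g) :
    Mfd.{u} :=
  letI := FPSet.chartedSpace hf hg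
  letI := FPSet.isManifold hf hg
  { carrier := FPSet f g, dim := FPSet.fdim M N P }

namespace FP

section
variable {X Y Z : Type u} {f : X → Z} {g : Y → Z}

/-- The first projection. -/
def fst (z : FPSet f g) : X := FPSet.fst z
/-- The second projection. -/
def snd (z : FPSet f g) : Y := FPSet.snd z
theorem w (z : FPSet f g) : f (fst z) = g (snd z) := FPSet.eq z
/-- The point of the fibre product with given components. -/
def mk (a : X) (b : Y) (h : f a = g b) : FPSet f g := FPSet.mk a b h

@[simp] theorem fst_mk (a : X) (b : Y) (h : f a = g b) : fst (mk a b h : FPSet f g) = a := rfl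
@[simp] theorem snd_mk (a : X) (b : Y) (h : f a = g b) : snd (mk a b h : FPSet f g) = b := rfl
theorem ext {z z' : FPSet f g} (h1 : fst z = fst z') (h2 : snd z = snd z') : z = z' :=
  FPSet.ext h1 h2
end

variable {M N P : Mfd.{u}} {f : M → P} {g : N → P} {hf : Subm f} {hg : Smooth g}

theorem smooth_fst_snd : Smooth (M := FP f g hf hg) fst ∧ Smooth (M := FP f g hf hg) snd := by
  let := FPSet.chartedSpace hf hg
  have key : ∀ z : FPSet f g, ContMDiffAt (𝓡 (FPSet.fdim M N P)) (𝓡 M.dim) ∞ FPSet.fst z ∧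
      ContMDiffAt (𝓡 (FPSet.fdim M N P)) (𝓡 N.dim) ∞ (FPSet.snd : FPSet f g → N) z := by
    intro z
    set p := (FPSet.exists_pre (g := g) hf z).some with hp
    have hz : chartAt (EuclideanSpace ℝ (Fin (FPSet.fdim M N P))) z = p.chart hg := rfl
    have hm := mem_chart_source (EuclideanSpace ℝ (Fin (FPSet.fdim M N P))) z
    have ho := (chartAt (EuclideanSpace ℝ (Fin (FPSet.fdim M N P))) z).open_source.mem_nhds hm
    have hc : ContMDiffAt (𝓡 (FPSet.fdim M N P)) (𝓡 (FPSet.fdim M N P)) ∞ (p.chart hg) z := by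
      have := contMDiffAt_extChartAt (I := 𝓡 (FPSet.fdim M N P)) (n := ∞) (x := z)
      simpa [hz] using this
    have ht : p.chart hg z ∈ p.tgt := (p.chart hg).map_source (by rw [← hz]; exact hm)
    have hT := (p.isOpen_tgt hg).mem_nhds ht
    constructor
    · refine (((p.contMDiffOn_a hg).contMDiffAt hT).comp z hc).congr_of_eventuallyEq ?_
      filter_upwards [ho] with y hy
      rw [hz] at hy
      rw [Function.comp_apply, ← p.chart_symm_fst hg ((p.chart hg).map_source hy),
        (p.chart hg).left_inv hy]
    · refine (((p.contMDiffOn_b hg).contMDiffAt hT).comp z hc).congr_of_eventuallyEq ?_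
      filter_upwards [ho] with y hy
      rw [hz] at hy
      rw [Function.comp_apply, ← p.chart_symm_snd hg ((p.chart hg).map_source hy),
        (p.chart hg).left_inv hy]
  exact ⟨fun z => (key z).1, fun z => (key z).2⟩

theorem smooth_fst : Smooth (M := FP f g hf hg) fst := smooth_fst_snd.1
theorem smooth_snd : Smooth (M := FP f g hf hg) snd := smooth_fst_snd.2

section lift
variable {E H X : Type*} [NormedAddCommGroup E] [NormedSpace ℝ E]
    [TopologicalSpace H] {I : ModelWithCorners ℝ E H} [TopologicalSpace X] [ChartedSpace H X]

/-- A map into the fibre product is smooth as soon as its components are. -/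
theorem contMDiffWithinAt_iff {c : X → FP f g hf hg} {s : Set X} {x : X} :
    ContMDiffWithinAt I (𝓡 (FP f g hf hg).dim) ∞ c s x ↔
      ContMDiffWithinAt I (𝓡 M.dim) ∞ (fun y => (fst (c y))) s x ∧
      ContMDiffWithinAt I (𝓡 N.dim) ∞ (fun y => (snd (c y))) s x := by
  constructor
  · intro h
    exact ⟨smooth_fst.contMDiffAt.comp_contMDiffWithinAt x h,
      smooth_snd.contMDiffAt.comp_contMDiffWithinAt x h⟩
  rintro ⟨h1, h2⟩
  let := FPSet.chartedSpace hf hg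
  have key : ∀ c : X → FPSet f g,
      ContMDiffWithinAt I (𝓡 M.dim) ∞ (fun y => (c y).fst) s x →
      ContMDiffWithinAt I (𝓡 N.dim) ∞ (fun y => (c y).snd) s x →
      ContMDiffWithinAt I (𝓡 (FPSet.fdim M N P)) ∞ c s x := by
    intro c h1 h2
    rw [contMDiffWithinAt_iff_target]
    refine ⟨FPSet.isEmbedding_toProd.isInducing.continuousWithinAt_iff.2
      (h1.continuousWithinAt.prodMk h2.continuousWithinAt), ?_⟩
    set p := (FPSet.exists_pre (g := g) hf (c x)).some with hp
    have hz : extChartAt (𝓡 (FPSet.fdim M N P)) (c x) =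
      (p.chart hg).toPartialEquiv := by
      rw [extChartAt, OpenPartialHomeomorph.extend]
      simp
      rfl
    have k1 := (contMDiffAt_of_mem_maximalAtlas p.hφ p.mφ).comp_contMDiffWithinAt x h1
    have k2 := (contMDiffAt_of_mem_maximalAtlas p.hη p.mη).comp_contMDiffWithinAt x h2
    have k3 := (contDiff_snd.comp p.e.contDiff).contMDiff.contMDiffAt.comp_contMDiffWithinAt x k1
    rw [hz]
    exact p.L.symm.contDiff.contMDiff.contMDiffAt.comp_contMDiffWithinAt x (k3.prodMk_space k2)
  exact key c h1 h2

theorem contMDiffOn_iff {c : X → FP f g hf hg} {s : Set X} :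
    ContMDiffOn I (𝓡 (FP f g hf hg).dim) ∞ c s ↔
      ContMDiffOn I (𝓡 M.dim) ∞ (fun y => (fst (c y))) s ∧
      ContMDiffOn I (𝓡 N.dim) ∞ (fun y => (snd (c y))) s := by
  simp only [ContMDiffOn, contMDiffWithinAt_iff]
  exact ⟨fun h => ⟨fun x hx => (h x hx).1, fun x hx => (h x hx).2⟩,
    fun h x hx => ⟨h.1 x hx, h.2 x hx⟩⟩

theorem contMDiffAt_iff {c : X → FP f g hf hg} {x : X} :
    ContMDiffAt I (𝓡 (FP f g hf hg).dim) ∞ c x ↔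
      ContMDiffAt I (𝓡 M.dim) ∞ (fun y => (fst (c y))) x ∧
      ContMDiffAt I (𝓡 N.dim) ∞ (fun y => (snd (c y))) x := contMDiffWithinAt_iff

theorem contMDiff_iff {c : X → FP f g hf hg} :
    ContMDiff I (𝓡 (FP f g hf hg).dim) ∞ c ↔
      ContMDiff I (𝓡 M.dim) ∞ (fun y => (fst (c y))) ∧
      ContMDiff I (𝓡 N.dim) ∞ (fun y => (snd (c y))) := by
  simp only [ContMDiff, contMDiffAt_iff, forall_and]

end lift

open Classical in
/-- Gluing of components that are compatible near a point. -/
theorem exists_lift {X : Mfd.{u}} {a : X → M} {b : X → N} {x : X} (ha : SmoothAt a x)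
    (hb : SmoothAt b x) (h : ∀ᶠ y in 𝓝 x, f (a y) = g (b y)) :
    ∃ c : X → FP f g hf hg, SmoothAt c x ∧ (fst (c x)) = a x ∧ (snd (c x)) = b x ∧
      ∀ᶠ y in 𝓝 x, (fst (c y)) = a y ∧ (snd (c y)) = b y := by
  have h0 := h.self_of_nhds
  set c : X → FP f g hf hg := fun y =>
    if h' : f (a y) = g (b y) then mk (a y) (b y) h' else mk (a x) (b x) h0 with hc
  have hE : ∀ᶠ y in 𝓝 x, (fst (c y)) = a y ∧ (snd (c y)) = b y := by
    filter_upwards [h] with y hy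
    simp [hc, hy]
  exact ⟨c, contMDiffAt_iff.2 ⟨ha.congr_of_eventuallyEq (hE.mono fun _ h => h.1),
    hb.congr_of_eventuallyEq (hE.mono fun _ h => h.2)⟩, hE.self_of_nhds.1, hE.self_of_nhds.2, hE⟩

end FP

/-- Through every point of the source there passes a smooth local section of `f`. -/
def HasSec {M N : Mfd.{u}} (f : M → N) : Prop :=
  ∀ x, ∃ σ : N → M, SmoothAt σ (f x) ∧ σ (f x) = x ∧ ∀ᶠ y in 𝓝 (f x), f (σ y) = y

namespace Mfd

theorem Subm.smooth {M N : Mfd.{u}} {f : M → N} (hf : Subm f) : Smooth f :=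
  Manifold.IsSubmersion.contMDiff hf

theorem Subm.hasSec {M N : Mfd.{u}} {f : M → N} (hf : Subm f) : HasSec f := by
  intro x
  obtain ⟨F, i1, i2, h⟩ := hf
  have h := h x
  set φ := h.domChart
  set ψ := h.codChart
  set e := h.equiv
  have he : ∀ w ∈ φ.target, ψ (f (φ.symm w)) = (e w).1 := by
    intro w hw
    have hw' : w ∈ (h.domChart.extend (𝓡 M.dim)).target := by simpa using hw
    have := h.writtenInCharts hw'
    simpa using this
  have hx : x ∈ φ.source := h.mem_domChart_source
  have hfx : f x ∈ ψ.source := h.mem_codChart_source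
  have hs : φ.source ⊆ f ⁻¹' ψ.source := h.source_subset_preimage_source
  set k : N → EuclideanSpace ℝ (Fin M.dim) := fun y => e.symm (ψ y, (e (φ x)).2) with hk
  have hk0 : k (f x) = φ x := by
    have := he _ (φ.map_source hx)
    rw [φ.left_inv hx] at this
    simp [hk, this]
  have hks : ContMDiffAt (𝓡 N.dim) (𝓡 M.dim) ∞ k (f x) :=
    e.symm.contDiff.contMDiff.contMDiffAt.comp _
      ((contMDiffAt_of_mem_maximalAtlas h.codChart_mem_maximalAtlas hfx).prodMk_space
        contMDiffAt_const)
  have hmem : ∀ᶠ y in 𝓝 (f x), k y ∈ φ.target :=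
    hks.continuousAt.eventually_mem (by
      rw [hk0]; exact φ.open_target.mem_nhds (φ.map_source hx))
  refine ⟨fun y => φ.symm (k y), ?_, ?_, ?_⟩
  · refine ContMDiffAt.comp (f x) ?_ hks
    rw [hk0]
    exact contMDiffAt_symm_of_mem_maximalAtlas h.domChart_mem_maximalAtlas (φ.map_source hx)
  · simp only [hk0, φ.left_inv hx]
  · filter_upwards [hmem, ψ.open_source.mem_nhds hfx] with y hy hy'
    refine ψ.injOn (hs (φ.map_target hy)) hy' ?_
    rw [he _ hy]
    simp [hk]

/-- A map `H` of a normed space with derivative the identity at `a` restricts to a smooth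
chart on a neighbourhood of `a` contained in a given neighbourhood on which it is smooth. -/
theorem exists_localDiffeo {E : Type*} [NormedAddCommGroup E] [NormedSpace ℝ E]
    [CompleteSpace E] {H : E → E} {a : E} {U : Set E} (hU : IsOpen U) (ha : a ∈ U)
    (hH : ContDiffOn ℝ ∞ H U) (hd : HasFDerivAt H (ContinuousLinearEquiv.refl ℝ E : E →L[ℝ] E) a) :
    ∃ θ : OpenPartialHomeomorph E E, a ∈ θ.source ∧ θ.source ⊆ U ∧ (∀ x, θ x = H x) ∧
      ContDiffOn ℝ ∞ θ θ.source ∧ ContDiffOn ℝ ∞ θ.symm θ.target := by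
  have hHa : ∀ x ∈ U, ContDiffAt ℝ ∞ H x := fun x hx => hH.contDiffAt (hU.mem_nhds hx)
  set θ0 := (hHa a ha).toOpenPartialHomeomorph H hd (by simp) with hθ0
  have hc : ContinuousOn (fderiv ℝ H) U := hH.continuousOn_fderiv_of_isOpen hU (by simp)
  have hdf : fderiv ℝ H a = (ContinuousLinearEquiv.refl ℝ E : E →L[ℝ] E) := hd.fderiv
  set V := U ∩ fderiv ℝ H ⁻¹' (interior (range ((↑) : (E ≃L[ℝ] E) → E →L[ℝ] E))) with hV
  have hVo : IsOpen V := hc.isOpen_inter_preimage hU isOpen_interior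
  have haV : a ∈ V := by
    refine ⟨ha, ?_⟩
    rw [mem_preimage, hdf, mem_interior_iff_mem_nhds]
    exact ContinuousLinearEquiv.nhds _
  have hsrc : (θ0.restr V).source = θ0.source ∩ V := by
    rw [θ0.restr_source, hVo.interior_eq]
  refine ⟨θ0.restr V, ?_, ?_, fun x => rfl, ?_, ?_⟩
  · rw [hsrc]
    exact ⟨(hHa a ha).mem_toOpenPartialHomeomorph_source hd (by simp), haV⟩
  · rw [hsrc]; exact fun x hx => hx.2.1
  · rw [hsrc]; exact hH.mono fun x hx => hx.2.1
  · intro y hy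
    have hx := (θ0.restr V).map_target hy
    rw [hsrc] at hx
    obtain ⟨L, hL⟩ := interior_subset hx.2.2
    have hx1 := hHa _ hx.2.1
    have hx2 : HasFDerivAt H (L : E →L[ℝ] E) ((θ0.restr V).symm y) := by
      rw [hL]; exact (hx1.differentiableAt (by simp)).hasFDerivAt
    exact ((θ0.restr V).contDiffAt_symm hy hx2 hx1).contDiffWithinAt

theorem subm_of_hasSec {M N : Mfd.{u}} {f : M → N} (hs : Smooth f) (hf : HasSec f) : Subm f := by
  refine ⟨EuclideanSpace ℝ (Fin (M.dim - N.dim)), inferInstance, inferInstance, fun x => ?_⟩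
  obtain ⟨σ, hσ, hσx, hfσ⟩ := hf x
  set E := EuclideanSpace ℝ (Fin M.dim)
  set E' := EuclideanSpace ℝ (Fin N.dim)
  set φ := chartAt E x with hφ
  set ψ := chartAt E' (f x) with hψ
  have mφ : φ ∈ IsManifold.maximalAtlas (𝓡 M.dim) ∞ M := IsManifold.chart_mem_maximalAtlas x
  have mψ : ψ ∈ IsManifold.maximalAtlas (𝓡 N.dim) ∞ N := IsManifold.chart_mem_maximalAtlas (f x)
  have hx : x ∈ φ.source := mem_chart_source _ _
  have hfx : f x ∈ ψ.source := mem_chart_source _ _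
  set a := φ x with ha
  set b := ψ (f x) with hb
  -- `f` in the charts, on an open set
  set U := φ.target ∩ (f ∘ φ.symm) ⁻¹' ψ.source with hU
  have hfφ : ContMDiffOn (𝓡 M.dim) (𝓡 N.dim) ∞ (f ∘ φ.symm) φ.target :=
    hs.comp_contMDiffOn (contMDiffOn_symm_of_mem_maximalAtlas mφ)
  have hUo : IsOpen U := hfφ.continuousOn.isOpen_inter_preimage φ.open_target ψ.open_source
  have haU : a ∈ U := ⟨φ.map_source hx, by simpa [ha, φ.left_inv hx] using hfx⟩
  set g : E → E' := fun w => ψ (f (φ.symm w)) with hg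
  have hgU : ContDiffOn ℝ ∞ g U := contMDiffOn_iff_contDiffOn.1
    ((contMDiffOn_of_mem_maximalAtlas mψ).comp (hfφ.mono fun w hw => hw.1) fun w hw => hw.2)
  have hga : ContDiffAt ℝ ∞ g a := hgU.contDiffAt (hUo.mem_nhds haU)
  set A := fderiv ℝ g a with hA
  have hgA : HasFDerivAt g A a := (hga.differentiableAt (by simp)).hasFDerivAt
  -- the derivative is surjective
  have hAs : Function.Surjective A := by
    set s : E' → E := fun v => φ (σ (ψ.symm v)) with hs'
    have hψb : ψ.symm b = f x := ψ.left_inv hfx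
    have hsb : s b = a := by simp [hs', hψb, hσx, ha]
    have h1 : ContMDiffAt (𝓡 N.dim) (𝓡 N.dim) ∞ ψ.symm b :=
      contMDiffAt_symm_of_mem_maximalAtlas mψ (ψ.map_source hfx)
    have h2 : ContMDiffAt (𝓡 N.dim) (𝓡 M.dim) ∞ (fun v => σ (ψ.symm v)) b :=
      ContMDiffAt.comp b (by rw [hψb]; exact hσ) h1
    have h3 : ContDiffAt ℝ ∞ s b := contMDiffAt_iff_contDiffAt.1 <|
      ContMDiffAt.comp b (contMDiffAt_of_mem_maximalAtlas mφ (by simpa [hψb, hσx] using hx)) h2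
    have h4 : ∀ᶠ v in 𝓝 b, g (s v) = v := by
      have e1 : ∀ᶠ v in 𝓝 b, v ∈ ψ.target := ψ.open_target.mem_nhds (ψ.map_source hfx)
      have e2 : ∀ᶠ v in 𝓝 b, f (σ (ψ.symm v)) = ψ.symm v := by
        have := h1.continuousAt
        rw [ContinuousAt, hψb] at this
        exact this.eventually hfσ
      have e3 : ∀ᶠ v in 𝓝 b, σ (ψ.symm v) ∈ φ.source :=
        h2.continuousAt.eventually_mem (by
          simp only [hψb, hσx]; exact φ.open_source.mem_nhds hx)
      filter_upwards [e1, e2, e3] with v v1 v2 v3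
      simp [hg, hs', φ.left_inv v3, v2, ψ.right_inv v1]
    have h5 : HasFDerivAt s (fderiv ℝ s b) b := (h3.differentiableAt (by simp)).hasFDerivAt
    have h6 : HasFDerivAt (fun v => g (s v)) (A.comp (fderiv ℝ s b)) b :=
      HasFDerivAt.comp (g := g) (f := s) b (by rw [hsb]; exact hgA) h5
    have h7 : HasFDerivAt (fun v => g (s v)) (ContinuousLinearMap.id ℝ E') b :=
      (hasFDerivAt_id b).congr_of_eventuallyEq h4
    intro v
    exact ⟨fderiv ℝ s b v, by
      simpa using congrArg (fun T : E' →L[ℝ] E' => T v) (h6.unique h7)⟩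
  -- a linear splitting
  obtain ⟨e, he⟩ : ∃ e : E ≃L[ℝ] (E' × EuclideanSpace ℝ (Fin (M.dim - N.dim))),
      ∀ v, (e v).1 = A v := by
    have hr := A.toLinearMap.finrank_range_add_finrank_ker
    have hrt : A.toLinearMap.range = ⊤ := LinearMap.range_eq_top.2 hAs
    rw [hrt, finrank_top, finrank_euclideanSpace_fin, finrank_euclideanSpace_fin] at hr
    obtain ⟨Q, hQ⟩ := A.toLinearMap.ker.exists_isCompl
    have hk : Module.finrank ℝ A.toLinearMap.ker =
        Module.finrank ℝ (EuclideanSpace ℝ (Fin (M.dim - N.dim))) := by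
      rw [finrank_euclideanSpace_fin]; omega
    let pr := Submodule.projectionOnto _ _ hQ
    let e1 : E ≃ₗ[ℝ] E' × A.toLinearMap.ker :=
      LinearMap.equivProdOfSurjectiveOfIsCompl A.toLinearMap pr hrt
        (Submodule.range_projectionOnto _) (by rw [Submodule.ker_projectionOnto]; exact hQ)
    let e2 := e1.trans (LinearEquiv.prodCongr (LinearEquiv.refl ℝ E')
      (LinearEquiv.ofFinrankEq _ _ hk))
    exact ⟨e2.toContinuousLinearEquiv, fun v => rfl⟩
  -- the straightening map
  set H : E → E := fun u => e.symm (g u, (e u).2) with hH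
  have hHU : ContDiffOn ℝ ∞ H U := e.symm.contDiff.comp_contDiffOn
    (hgU.prodMk (contDiff_snd.comp e.contDiff).contDiffOn)
  have hHd : HasFDerivAt H (ContinuousLinearEquiv.refl ℝ E : E →L[ℝ] E) a := by
    have h0 : HasFDerivAt (fun u => (e u).2) ((ContinuousLinearMap.snd ℝ E'
        (EuclideanSpace ℝ (Fin (M.dim - N.dim)))).comp e.toContinuousLinearMap) a :=
      ((ContinuousLinearMap.snd ℝ E'
        (EuclideanSpace ℝ (Fin (M.dim - N.dim)))).comp e.toContinuousLinearMap).hasFDerivAt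
    have h1 := hgA.prodMk h0
    have h2 := e.symm.toContinuousLinearMap.hasFDerivAt.comp a h1
    refine h2.congr_fderiv ?_
    ext1 v
    change e.symm (A v, (e v).2) = v
    rw [← he]
    simp
  obtain ⟨θ, hθa, hθU, hθH, hθ1, hθ2⟩ := exists_localDiffeo hUo haU hHU hHd
  have hc1 : ContMDiffOn (𝓡 M.dim) (𝓡 M.dim) ∞ θ θ.source := contMDiffOn_iff_contDiffOn.2 hθ1
  have hc2 : ContMDiffOn (𝓡 M.dim) (𝓡 M.dim) ∞ θ.symm θ.target := contMDiffOn_iff_contDiffOn.2 hθ2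
  have hmem : φ ≫ₕ θ ∈ IsManifold.maximalAtlas (𝓡 M.dim) ∞ M := by
    apply OpenPartialHomeomorph.mem_maximalAtlas_of_contMDiffOn
    · exact hc1.comp ((contMDiffOn_of_mem_maximalAtlas mφ).mono fun y hy => hy.1) fun y hy => hy.2
    · exact (contMDiffOn_symm_of_mem_maximalAtlas mφ).comp (hc2.mono fun y hy => hy.1)
        fun y hy => hy.2
  refine Manifold.IsSubmersionAtOfComplement.mk_of_continuousAt hs.continuous.continuousAt e
    (φ ≫ₕ θ) ψ ⟨hx, hθa⟩ hfx hmem mψ ?_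
  intro w hw
  have hw' : w ∈ (φ ≫ₕ θ).target := by simpa using hw
  have h1 : θ (θ.symm w) = w := θ.right_inv hw'.1
  rw [hθH] at h1
  have h2 := congrArg (fun v => (e v).1) h1
  simp only [hH, ContinuousLinearEquiv.apply_symm_apply] at h2
  simpa [hg] using h2

theorem subm_iff_hasSec {M N : Mfd.{u}} {f : M → N} : Subm f ↔ Smooth f ∧ HasSec f :=
  ⟨fun h => ⟨h.smooth, h.hasSec⟩, fun h => subm_of_hasSec h.1 h.2⟩

end Mfd

namespace Mfd

theorem Subm.comp {M N P : Mfd.{u}} {f : M → N} {g : N → P} (hg : Subm g) (hf : Subm f) :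
    Subm fun x => g (f x) := by
  refine subm_of_hasSec (hg.smooth.comp hf.smooth) fun x => ?_
  obtain ⟨σ, h1, h2, h3⟩ := hf.hasSec x
  obtain ⟨τ, k1, k2, k3⟩ := hg.hasSec (f x)
  refine ⟨fun y => σ (τ y), ContMDiffAt.comp _ (by rw [k2]; exact h1) k1, by simp only [k2, h2], ?_⟩
  have := k1.continuousAt
  rw [ContinuousAt, k2] at this
  filter_upwards [this.eventually h3, k3] with y y1 y2
  simp only [y1, y2]

theorem SurjSubm.smooth {M N : Mfd.{u}} {f : M → N} (hf : SurjSubm f) : Smooth f := hf.subm.smooth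

theorem SurjSubm.comp {M N P : Mfd.{u}} {f : M → N} {g : N → P} (hg : SurjSubm g)
    (hf : SurjSubm f) : SurjSubm fun x => g (f x) :=
  ⟨hg.subm.comp hf.subm, hg.surj.comp hf.surj⟩

end Mfd

namespace FP

variable {M N P : Mfd.{u}} {f : M → P} {g : N → P}

theorem surjSubm_snd (hf : SurjSubm f) (hg : Smooth g) :
    SurjSubm (M := FP f g hf.subm hg) snd := by
  refine ⟨subm_of_hasSec smooth_snd fun z => ?_, fun y => ?_⟩
  · obtain ⟨σ, h1, h2, h3⟩ := hf.subm.hasSec (fst z)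
    rw [(w z)] at h1 h2 h3
    obtain ⟨c, c1, c2, c3, c4⟩ := exists_lift (hf := hf.subm) (hg := hg) (x := (snd z))
      (a := fun y => σ (g y)) (b := fun y => y) (ContMDiffAt.comp (snd z) h1 hg.contMDiffAt)
      contMDiffAt_id (hg.continuous.continuousAt.eventually h3)
    exact ⟨c, c1, FP.ext (c2.trans h2) c3, c4.mono fun y hy => hy.2⟩
  · obtain ⟨x, hx⟩ := hf.surj (g y)
    exact ⟨mk x y hx, rfl⟩

theorem surjSubm_fst (hf : Subm f) (hg : SurjSubm g) :
    SurjSubm (M := FP f g hf hg.smooth) fst := by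
  refine ⟨subm_of_hasSec smooth_fst fun z => ?_, fun y => ?_⟩
  · obtain ⟨σ, h1, h2, h3⟩ := hg.subm.hasSec (snd z)
    rw [← (w z)] at h1 h2 h3
    obtain ⟨c, c1, c2, c3, c4⟩ := exists_lift (hf := hf) (hg := hg.smooth) (x := (fst z))
      (a := fun y => y) (b := fun y => σ (f y)) contMDiffAt_id
      (ContMDiffAt.comp (fst z) h1 hf.smooth.contMDiffAt)
      ((hf.smooth.continuous.continuousAt.eventually h3).mono fun y hy => hy.symm)
    exact ⟨c, c1, FP.ext c2 (c3.trans h2), c4.mono fun y hy => hy.1⟩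
  · obtain ⟨x, hx⟩ := hg.surj (f y)
    exact ⟨mk y x hx.symm, rfl⟩

end FP

/-- A Lie groupoid with manifold of objects `M`. The product `mul x y` is defined when the target
of `x` is the source of `y`. -/
structure LieGroupoid (M : Mfd.{u}) where
  arr : Mfd.{u}
  s : arr → M
  t : arr → M
  one : M → arr
  inv : arr → arr
  mul : ∀ x y : arr, t x = s y → arr
  hs : SurjSubm s
  ht : SurjSubm t
  smooth_one : Smooth one
  smooth_inv : Smooth inv
  smooth_mul : Smooth fun z : FP t s ht.subm hs.subm.smooth => mul (FP.fst z) (FP.snd z) (FP.w z)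
  s_one : ∀ m, s (one m) = m
  t_one : ∀ m, t (one m) = m
  s_inv : ∀ x, s (inv x) = t x
  t_inv : ∀ x, t (inv x) = s x
  s_mul : ∀ x y h, s (mul x y h) = s x
  t_mul : ∀ x y h, t (mul x y h) = t y
  one_mul : ∀ x, mul (one (s x)) x (t_one _) = x
  mul_one : ∀ x, mul x (one (t x)) (s_one _).symm = x
  mul_inv : ∀ x, mul x (inv x) (s_inv x).symm = one (s x)
  inv_mul : ∀ x, mul (inv x) x (t_inv x) = one (t x)
  mul_assoc : ∀ x y z h h', mul (mul x y h) z ((t_mul x y h).trans h') =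
    mul x (mul y z h') (h.trans (s_mul y z h').symm)

namespace LieGroupoid

variable {M M' : Mfd.{u}}

/-- The conjugate `r k r⁻¹`. -/
noncomputable def conj (R : LieGroupoid M) (r k : R.arr) (h : R.t r = R.s k) (h' : R.t k = R.t r) : R.arr :=
  R.mul (R.mul r k h) (R.inv r) ((R.t_mul r k h).trans (h'.trans (R.s_inv r).symm))

/-- Morphisms of Lie groupoids over the identity of the manifold of objects. -/
structure IsMorphism (R S : LieGroupoid M) (φ : R.arr → S.arr) : Prop where
  smooth : Smooth φ
  s_map : ∀ x, S.s (φ x) = R.s x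
  t_map : ∀ x, S.t (φ x) = R.t x
  map_mul : ∀ x y h, φ (R.mul x y h) =
    S.mul (φ x) (φ y) ((t_map x).trans (h.trans (s_map y).symm))

/-- Isomorphisms of Lie groupoids over the identity of the manifold of objects. -/
structure Iso (R S : LieGroupoid M) where
  toFun : R.arr → S.arr
  invFun : S.arr → R.arr
  left_inv : ∀ x, invFun (toFun x) = x
  right_inv : ∀ x, toFun (invFun x) = x
  mor : IsMorphism R S toFun
  mor_inv : IsMorphism S R invFun

/-- The inverse isomorphism. -/
noncomputable def Iso.symm {R S : LieGroupoid M} (Θ : Iso R S) : Iso S R :=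
  ⟨Θ.invFun, Θ.toFun, Θ.right_inv, Θ.left_inv, Θ.mor_inv, Θ.mor⟩

theorem IsMorphism.comp {R S T : LieGroupoid M} {φ : R.arr → S.arr} {ψ : S.arr → T.arr}
    (hψ : IsMorphism S T ψ) (hφ : IsMorphism R S φ) : IsMorphism R T fun x => ψ (φ x) where
  smooth := hψ.smooth.comp hφ.smooth
  s_map x := (hψ.s_map _).trans (hφ.s_map x)
  t_map x := (hψ.t_map _).trans (hφ.t_map x)
  map_mul x y h := by rw [hφ.map_mul, hψ.map_mul]

/-- Composition of isomorphisms. -/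
noncomputable def Iso.trans {R S T : LieGroupoid M} (Θ : Iso R S) (Λ : Iso S T) : Iso R T where
  toFun x := Λ.toFun (Θ.toFun x)
  invFun x := Θ.invFun (Λ.invFun x)
  left_inv x := by rw [Λ.left_inv, Θ.left_inv]
  right_inv x := by rw [Θ.right_inv, Λ.right_inv]
  mor := Λ.mor.comp Θ.mor
  mor_inv := Θ.mor_inv.comp Λ.mor_inv

/-- The manifold of arrows `M' ×_M 𝒢 ×_M M'` of the pull-back groupoid along `p : M' → M`,
consisting of triples `(src, mid, tgt)` with `p src = s mid` and `t mid = p tgt`. -/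
noncomputable def PB (𝒢 : LieGroupoid M) (p : M' → M) (hp : SurjSubm p) : Mfd.{u} :=
  FP p (fun a : FP p 𝒢.s hp.subm 𝒢.hs.smooth => 𝒢.t (FP.snd a)) hp.subm
    (𝒢.ht.smooth.comp FP.smooth_snd)

/-- The set of triples `(x, γ, y)` with `p x = s γ` and `t γ = p y`. -/
abbrev PBSet {X A Y : Type u} (s t : A → Y) (p : X → Y) : Type u :=
  FPSet p (fun a : FPSet p s => t (FP.snd a))

namespace PB

section
variable {X A Y : Type u} {s t : A → Y} {p : X → Y}

/-- First component of an arrow of the pull-back groupoid. -/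
def src (z : PBSet s t p) : X := FP.fst (FP.snd z)
/-- Middle component of an arrow of the pull-back groupoid. -/
def mid (z : PBSet s t p) : A := FP.snd (FP.snd z)
/-- Last component of an arrow of the pull-back groupoid. -/
def tgt (z : PBSet s t p) : X := FP.fst z

theorem ws (z : PBSet s t p) : p (PB.src z) = s (PB.mid z) := FP.w (FP.snd z)
theorem wt (z : PBSet s t p) : t (PB.mid z) = p (PB.tgt z) := (FP.w z).symm

/-- The arrow `(x, γ, y)` of the pull-back groupoid. -/
def mk (x : X) (γ : A) (y : X) (h : p x = s γ) (h' : t γ = p y) : PBSet s t p :=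
  FP.mk y (FP.mk x γ h) h'.symm

theorem ext {z z' : PBSet s t p} (h1 : PB.src z = PB.src z') (h2 : PB.mid z = PB.mid z')
    (h3 : PB.tgt z = PB.tgt z') : z = z' :=
  FP.ext h3 (FP.ext h1 h2)
end

variable {𝒢 : LieGroupoid M} {p : M' → M} (hp : SurjSubm p)

theorem smooth_src : Smooth (M := PB 𝒢 p hp) src := FP.smooth_fst.comp FP.smooth_snd
theorem smooth_mid : Smooth (M := PB 𝒢 p hp) mid := FP.smooth_snd.comp FP.smooth_snd
theorem smooth_tgt : Smooth (M := PB 𝒢 p hp) tgt := FP.smooth_fst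

theorem contMDiffOn {E H X : Type*} [NormedAddCommGroup E] [NormedSpace ℝ E]
    [TopologicalSpace H] {I : ModelWithCorners ℝ E H} [TopologicalSpace X] [ChartedSpace H X]
    {c : X → PB 𝒢 p hp} {s : Set X}
    (h1 : ContMDiffOn I (𝓡 M'.dim) ∞ (fun x => (PB.src (c x))) s)
    (h2 : ContMDiffOn I (𝓡 𝒢.arr.dim) ∞ (fun x => (PB.mid (c x))) s)
    (h3 : ContMDiffOn I (𝓡 M'.dim) ∞ (fun x => (PB.tgt (c x))) s) :
    ContMDiffOn I (𝓡 (PB 𝒢 p hp).dim) ∞ c s :=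
  FP.contMDiffOn_iff.2 ⟨h3, FP.contMDiffOn_iff.2 ⟨h1, h2⟩⟩

theorem contMDiff {E H X : Type*} [NormedAddCommGroup E] [NormedSpace ℝ E]
    [TopologicalSpace H] {I : ModelWithCorners ℝ E H} [TopologicalSpace X] [ChartedSpace H X]
    {c : X → PB 𝒢 p hp}
    (h1 : ContMDiff I (𝓡 M'.dim) ∞ fun x => (PB.src (c x)))
    (h2 : ContMDiff I (𝓡 𝒢.arr.dim) ∞ fun x => (PB.mid (c x)))
    (h3 : ContMDiff I (𝓡 M'.dim) ∞ fun x => (PB.tgt (c x))) :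
    ContMDiff I (𝓡 (PB 𝒢 p hp).dim) ∞ c :=
  FP.contMDiff_iff.2 ⟨h3, FP.contMDiff_iff.2 ⟨h1, h2⟩⟩

theorem surjSubm_tgt : SurjSubm (M := PB 𝒢 p hp) tgt :=
  FP.surjSubm_fst hp.subm (𝒢.ht.comp (FP.surjSubm_snd hp 𝒢.hs.smooth))

theorem surjSubm_src : SurjSubm (M := PB 𝒢 p hp) src :=
  (FP.surjSubm_fst hp.subm 𝒢.hs).comp
    (FP.surjSubm_snd hp (𝒢.ht.smooth.comp FP.smooth_snd))

theorem exists_lift {X : Mfd.{u}} {a b : X → M'} {γ : X → 𝒢.arr} {x : X} (ha : SmoothAt a x)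
    (hγ : SmoothAt γ x) (hb : SmoothAt b x) (h : ∀ᶠ y in 𝓝 x, p (a y) = 𝒢.s (γ y))
    (h' : ∀ᶠ y in 𝓝 x, 𝒢.t (γ y) = p (b y)) :
    ∃ c : X → PB 𝒢 p hp, SmoothAt c x ∧ (PB.src (c x)) = a x ∧ (PB.mid (c x)) = γ x ∧ (PB.tgt (c x)) = b x ∧
      ∀ᶠ y in 𝓝 x, (PB.src (c y)) = a y ∧ (PB.mid (c y)) = γ y ∧ (PB.tgt (c y)) = b y := by
  obtain ⟨c, c1, c2, c3, c4⟩ := FP.exists_lift (hf := hp.subm) (hg := 𝒢.hs.smooth) ha hγ h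
  have h'' : ∀ᶠ y in 𝓝 x, p (b y) = 𝒢.t (FP.snd (c y)) := by
    filter_upwards [h', c4] with y h1 h2
    rw [h2.2, h1]
  obtain ⟨d, d1, d2, d3, d4⟩ := FP.exists_lift (hf := hp.subm)
    (hg := 𝒢.ht.smooth.comp FP.smooth_snd) hb c1 h''
  refine ⟨d, d1, (congrArg FP.fst d3).trans c2, (congrArg FP.snd d3).trans c3, d2, ?_⟩
  filter_upwards [c4, d4] with y h1 h2
  exact ⟨(congrArg FP.fst h2.2).trans h1.1, (congrArg FP.snd h2.2).trans h1.2, h2.1⟩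

end PB

/-- The pull-back of a Lie groupoid along a surjective submersion. -/
noncomputable def pullback (𝒢 : LieGroupoid M) (p : M' → M) (hp : SurjSubm p) :
    LieGroupoid M' where
  arr := PB 𝒢 p hp
  s := PB.src
  t := PB.tgt
  one x := PB.mk x (𝒢.one (p x)) x (𝒢.s_one _).symm (𝒢.t_one _)
  inv z := PB.mk (PB.tgt z) (𝒢.inv (PB.mid z)) (PB.src z) ((PB.wt z).symm.trans (𝒢.s_inv _).symm)
    ((𝒢.t_inv _).trans (PB.ws z).symm)
  mul z z' h := PB.mk (PB.src z) (𝒢.mul (PB.mid z) (PB.mid z') ((PB.wt z).trans ((congrArg p h).trans (PB.ws z')))) (PB.tgt z')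
    ((PB.ws z).trans (𝒢.s_mul _ _ _).symm) ((𝒢.t_mul _ _ _).trans (PB.wt z'))
  hs := (PB.surjSubm_src hp)
  ht := (PB.surjSubm_tgt hp)
  smooth_one := (PB.contMDiff hp) contMDiff_id (𝒢.smooth_one.comp hp.smooth) contMDiff_id
  smooth_inv := (PB.contMDiff hp) (PB.smooth_tgt hp) (𝒢.smooth_inv.comp (PB.smooth_mid hp)) (PB.smooth_src hp)
  smooth_mul := by
    have k1 := PB.surjSubm_tgt (𝒢 := 𝒢) hp
    have k2 := PB.surjSubm_src (𝒢 := 𝒢) hp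
    have l1 := FP.smooth_fst (hf := k1.subm) (hg := k2.smooth)
    have l2 := FP.smooth_snd (hf := k1.subm) (hg := k2.smooth)
    have h1 := (PB.smooth_src (𝒢 := 𝒢) hp).comp l1
    have h2 := (PB.smooth_mid (𝒢 := 𝒢) hp).comp l1
    have h3 := (PB.smooth_mid (𝒢 := 𝒢) hp).comp l2
    have h4 := (PB.smooth_tgt (𝒢 := 𝒢) hp).comp l2
    refine PB.contMDiff hp h1 ?_ h4
    exact 𝒢.smooth_mul.comp (FP.contMDiff_iff.2 ⟨h2, h3⟩ :
      Smooth (M := FP (M := PB 𝒢 p hp) (N := PB 𝒢 p hp) PB.tgt PB.src k1.subm k2.smooth)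
      (N := FP 𝒢.t 𝒢.s 𝒢.ht.subm 𝒢.hs.smooth)
      fun z => FP.mk (PB.mid (FP.fst z)) (PB.mid (FP.snd z))
      ((PB.wt (FP.fst z)).trans ((congrArg p (FP.w z)).trans (PB.ws (FP.snd z)))))
  s_one _ := rfl
  t_one _ := rfl
  s_inv _ := rfl
  t_inv _ := rfl
  s_mul _ _ _ := rfl
  t_mul _ _ _ := rfl
  one_mul z := by
    refine PB.ext rfl ?_ rfl
    have := 𝒢.one_mul (PB.mid z)
    simp only [← (PB.ws z)] at this
    exact this
  mul_one z := by
    refine PB.ext rfl ?_ rfl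
    have := 𝒢.mul_one (PB.mid z)
    simp only [(PB.wt z)] at this
    exact this
  mul_inv z := by
    refine PB.ext rfl ?_ rfl
    exact (𝒢.mul_inv (PB.mid z)).trans (congrArg 𝒢.one (PB.ws z).symm)
  inv_mul z := by
    refine PB.ext rfl ?_ rfl
    exact (𝒢.inv_mul (PB.mid z)).trans (congrArg 𝒢.one (PB.wt z))
  mul_assoc x y z h h' := PB.ext rfl (𝒢.mul_assoc _ _ _ _ _) rfl

/-- The pull-back of a morphism of Lie groupoids. -/
noncomputable def pullbackMap {R S : LieGroupoid M} {φ : R.arr → S.arr} (hφ : IsMorphism R S φ)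
    (p : M' → M) (hp : SurjSubm p) (z : (R.pullback p hp).arr) : (S.pullback p hp).arr :=
  PB.mk (PB.src z) (φ (PB.mid z)) (PB.tgt z) ((PB.ws z).trans (hφ.s_map _).symm)
    ((hφ.t_map _).trans (PB.wt z))

theorem isMorphism_pullbackMap {R S : LieGroupoid M} {φ : R.arr → S.arr}
    (hφ : IsMorphism R S φ) (p : M' → M) (hp : SurjSubm p) :
    IsMorphism (R.pullback p hp) (S.pullback p hp) (pullbackMap hφ p hp) where
  smooth := (PB.contMDiff hp) (PB.smooth_src hp) (hφ.smooth.comp (PB.smooth_mid hp)) (PB.smooth_tgt hp)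
  s_map _ := rfl
  t_map _ := rfl
  map_mul _ _ _ := PB.ext rfl (hφ.map_mul _ _ _) rfl

/-- The pull-back of an isomorphism of Lie groupoids. -/
noncomputable def Iso.pullback {R S : LieGroupoid M} (Θ : Iso R S) (p : M' → M)
    (hp : SurjSubm p) : Iso (R.pullback p hp) (S.pullback p hp) where
  toFun := pullbackMap Θ.mor p hp
  invFun := pullbackMap Θ.mor_inv p hp
  left_inv _ := PB.ext rfl (Θ.left_inv _) rfl
  right_inv _ := PB.ext rfl (Θ.right_inv _) rfl
  mor := isMorphism_pullbackMap _ p hp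
  mor_inv := isMorphism_pullbackMap _ p hp

/-- The canonical isomorphism `𝒢[q][p] ≅ 𝒢[q ∘ p]`, `(x, (p x, γ, p y), y) ↦ (x, γ, y)`. -/
noncomputable def pullbackComp {B₀ : Mfd.{u}} (B : LieGroupoid B₀) (q : M → B₀) (hq : SurjSubm q)
    (p : M' → M) (hp : SurjSubm p) :
    Iso ((B.pullback q hq).pullback p hp) (B.pullback (fun x => q (p x)) (hq.comp hp)) where
  toFun z := PB.mk (PB.src z) (PB.mid (PB.mid z)) (PB.tgt z)
    ((congrArg q (PB.ws z)).trans (PB.ws (PB.mid z)))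
    ((PB.wt (PB.mid z)).trans (congrArg q (PB.wt z)))
  invFun z := PB.mk (PB.src z)
    (PB.mk (p (PB.src z)) (PB.mid z) (p (PB.tgt z)) (PB.ws z) (PB.wt z)) (PB.tgt z) rfl rfl
  left_inv z := PB.ext rfl (PB.ext (PB.ws z) rfl (PB.wt z).symm) rfl
  right_inv _ := rfl
  mor :=
    { smooth := PB.contMDiff (hq.comp hp) (PB.smooth_src hp)
        ((PB.smooth_mid hq).comp (PB.smooth_mid hp)) (PB.smooth_tgt hp)
      s_map := fun _ => rfl
      t_map := fun _ => rfl
      map_mul := fun _ _ _ => rfl }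
  mor_inv :=
    { smooth := PB.contMDiff hp (PB.smooth_src (hq.comp hp))
        (PB.contMDiff hq (hp.smooth.comp (PB.smooth_src (hq.comp hp)))
        (PB.smooth_mid (hq.comp hp)) (hp.smooth.comp (PB.smooth_tgt (hq.comp hp))))
        (PB.smooth_tgt (hq.comp hp))
      s_map := fun _ => rfl
      t_map := fun _ => rfl
      map_mul := fun _ _ _ => rfl }

/-- The identity `B[q] ≅ B[q']` for equal maps `q` and `q'`. -/
noncomputable def pullbackCongr {B₀ : Mfd.{u}} (B : LieGroupoid B₀) {q q' : M → B₀}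
    (hq : SurjSubm q) (hq' : SurjSubm q') (h : ∀ x, q x = q' x) :
    Iso (B.pullback q hq) (B.pullback q' hq') where
  toFun z := PB.mk (PB.src z) (PB.mid z) (PB.tgt z) ((h _).symm.trans (PB.ws z))
    ((PB.wt z).trans (h _))
  invFun z := PB.mk (PB.src z) (PB.mid z) (PB.tgt z) ((h _).trans (PB.ws z))
    ((PB.wt z).trans (h _).symm)
  left_inv _ := rfl
  right_inv _ := rfl
  mor :=
    { smooth := PB.contMDiff hq' (PB.smooth_src hq) (PB.smooth_mid hq) (PB.smooth_tgt hq)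
      s_map := fun _ => rfl
      t_map := fun _ => rfl
      map_mul := fun _ _ _ => rfl }
  mor_inv :=
    { smooth := PB.contMDiff hq (PB.smooth_src hq') (PB.smooth_mid hq') (PB.smooth_tgt hq')
      s_map := fun _ => rfl
      t_map := fun _ => rfl
      map_mul := fun _ _ _ => rfl }

end LieGroupoid

/-- A finite dimensional Lie group. -/
structure LieGrp : Type (u + 1) where
  toMfd : Mfd.{u}
  [group : Group toMfd]
  [lieGroup : LieGroup (𝓡 toMfd.dim) ∞ toMfd]

instance : CoeSort LieGrp.{u} (Type u) := ⟨fun G => G.toMfd.carrier⟩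

attribute [instance] LieGrp.group LieGrp.lieGroup

/-- A crossed module of Lie groups `G → H`. The action of `H` on `G` by automorphisms is smooth
as a map `H × G → G`. -/
structure CrossedModule : Type (u + 1) where
  G : LieGrp.{u}
  H : LieGrp.{u}
  ρ : G →* H
  smooth_ρ : Smooth (M := G.toMfd) (N := H.toMfd) ρ
  act : H →* MulAut G
  smooth_act : ContMDiff ((𝓡 H.toMfd.dim).prod (𝓡 G.toMfd.dim)) (𝓡 G.toMfd.dim) ∞
    fun x : H × G => act x.1 x.2
  ρ_act : ∀ h g, ρ (act h g) = h * ρ g * h⁻¹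
  act_ρ : ∀ g g', act (ρ g) g' = g * g' * g⁻¹

namespace LieGroupoid

variable {M M' : Mfd.{u}}

theorem IsMorphism.map_one {R S : LieGroupoid M} {φ : R.arr → S.arr} (hφ : IsMorphism R S φ)
    (m : M) : φ (R.one m) = S.one m := by
  have hs : S.s (φ (R.one m)) = m := (hφ.s_map _).trans (R.s_one m)
  have ht : S.t (φ (R.one m)) = m := (hφ.t_map _).trans (R.t_one m)
  set e := φ (R.one m) with he
  have h1 : S.mul e e (ht.trans hs.symm) = e := by
    have := hφ.map_mul (R.one m) (R.one m) ((R.t_one m).trans (R.s_one m).symm)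
    rw [← this]
    have h2 := R.mul_one (R.one m)
    simp only [R.t_one] at h2
    rw [h2]
  have h3 := S.mul_assoc e e (S.inv e) (ht.trans hs.symm) (S.s_inv e).symm
  have h4 : S.mul e (S.one (S.s e)) (by rw [S.s_one, ht, hs]) = e := by
    have := S.mul_one e
    simp only [ht] at this
    simp only [hs]
    exact this
  simp only [h1, S.mul_inv, h4] at h3
  rw [← h3, hs]

/-- The arrows in the fibre `K_m` of the kernel of `φ : R → 𝒢`. -/
def ker {R 𝒢 : LieGroupoid M} (φ : R.arr → 𝒢.arr) (m : M) : Set R.arr := {r | φ r = 𝒢.one m}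

theorem IsMorphism.s_of_ker {R 𝒢 : LieGroupoid M} {φ : R.arr → 𝒢.arr} (hφ : IsMorphism R 𝒢 φ)
    {m : M} {r : R.arr} (hr : r ∈ ker φ m) : R.s r = m := by
  rw [← hφ.s_map, show φ r = 𝒢.one m from hr, 𝒢.s_one]

theorem IsMorphism.t_of_ker {R 𝒢 : LieGroupoid M} {φ : R.arr → 𝒢.arr} (hφ : IsMorphism R 𝒢 φ)
    {m : M} {r : R.arr} (hr : r ∈ ker φ m) : R.t r = m := by
  rw [← hφ.t_map, show φ r = 𝒢.one m from hr, 𝒢.t_one]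

/-- The map `b` is an isomorphism of abstract groups from `G` onto the fibre `K_m` of the kernel
of `φ`. -/
structure IsKerIso {R 𝒢 : LieGroupoid M} (φ : R.arr → 𝒢.arr) {G : LieGrp.{u}} (m : M)
    (b : G → R.arr) : Prop where
  mem : ∀ g, b g ∈ ker φ m
  mul : ∀ g g', ∃ h, b (g * g') = R.mul (b g) (b g') h
  inj : Function.Injective b
  surj : ∀ r ∈ ker φ m, ∃ g, b g = r

/-- A Lie groupoid `G`-extension of `𝒢`: a surjective submersive morphism `φ : R → 𝒢` over the
identity whose kernel is a locally trivial bundle of Lie groups with typical fibre `G`. Over an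
open set `U` the trivialisation is `(m, g) ↦ τ m g`, with inverse `k ↦ (s k, σ k)`. -/
structure GExtension (G : LieGrp.{u}) (𝒢 : LieGroupoid M) where
  R : LieGroupoid M
  φ : R.arr → 𝒢.arr
  mor : IsMorphism R 𝒢 φ
  surjSubm : SurjSubm φ
  locTriv : ∀ x : M, ∃ (U : Set M) (τ : M → G → R.arr) (σ : R.arr → G), IsOpen U ∧ x ∈ U ∧
    ContMDiffOn ((𝓡 M.dim).prod (𝓡 G.toMfd.dim)) (𝓡 R.arr.dim) ∞
      (fun z : M × G => τ z.1 z.2) (U ×ˢ univ) ∧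
    ContMDiffOn (𝓡 R.arr.dim) (𝓡 G.toMfd.dim) ∞ σ {r | ∃ m ∈ U, r ∈ ker φ m} ∧
    ∀ m ∈ U, IsKerIso φ m (τ m) ∧ ∀ g, σ (τ m g) = g

/-- The fibre over `m` of the band of a `G`-extension: the Lie group isomorphisms from `G` onto the
fibre `K_m` of the kernel. -/
structure Band {G : LieGrp.{u}} {𝒢 : LieGroupoid M} (E : GExtension G 𝒢) (m : M) where
  toFun : G → E.R.arr
  iso : IsKerIso E.φ m toFun
  smooth : Smooth (M := G.toMfd) toFun
  smooth_inv : ∃ σ : E.R.arr → G,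
    ContMDiffOn (𝓡 E.R.arr.dim) (𝓡 G.toMfd.dim) ∞ σ (ker E.φ m) ∧ ∀ g, σ (toFun g) = g

namespace Band
variable {G : LieGrp.{u}} {𝒢 : LieGroupoid M} {E : GExtension G 𝒢} {m : M} (b : Band E m)

theorem s_eq (g : G) : E.R.s (b.toFun g) = m := E.mor.s_of_ker (b.iso.mem g)
theorem t_eq (g : G) : E.R.t (b.toFun g) = m := E.mor.t_of_ker (b.iso.mem g)
end Band

/-- A principal `H`-bundle over the Lie groupoid `R ⇉ M`: a (right) principal `H`-bundle
`π : P → M` with a left action of `R` that commutes with the action of `H`. Over an open set `U`,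
a local trivialisation is `(m, h) ↦ (s m) · h`, with inverse `p ↦ (π p, δ p)`. -/
structure PrincipalBundle (H : LieGrp.{u}) (R : LieGroupoid M) where
  P : Mfd.{u}
  π : P → M
  hπ : SurjSubm π
  ract : P → H → P
  smooth_ract : ContMDiff ((𝓡 P.dim).prod (𝓡 H.toMfd.dim)) (𝓡 P.dim) ∞
    fun x : P × H => ract x.1 x.2
  π_ract : ∀ p h, π (ract p h) = π p
  ract_one : ∀ p, ract p 1 = p
  ract_mul : ∀ p h h', ract (ract p h) h' = ract p (h * h')
  locTriv : ∀ x : M, ∃ (U : Set M) (s : M → P) (δ : P → H), IsOpen U ∧ x ∈ U ∧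
    ContMDiffOn (𝓡 M.dim) (𝓡 P.dim) ∞ s U ∧
    ContMDiffOn (𝓡 P.dim) (𝓡 H.toMfd.dim) ∞ δ (π ⁻¹' U) ∧
    (∀ m ∈ U, π (s m) = m ∧ ∀ h, δ (ract (s m) h) = h) ∧
    ∀ p, π p ∈ U → ract (s (π p)) (δ p) = p
  lact : ∀ (r : R.arr) (p : P), R.t r = π p → P
  smooth_lact : Smooth fun z : FP R.t π R.ht.subm hπ.smooth =>
    lact (FP.fst z) (FP.snd z) (FP.w z)
  π_lact : ∀ r p h, π (lact r p h) = R.s r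
  one_lact : ∀ p, lact (R.one (π p)) p (R.t_one _) = p
  mul_lact : ∀ r r' p h h', lact (R.mul r r' h) p ((R.t_mul r r' h).trans h') =
    lact r (lact r' p h') (h.trans (π_lact r' p h').symm)
  lact_ract : ∀ r p h k, ract (lact r p h) k = lact r (ract p k) (h.trans (π_ract p k).symm)

/-- A `G → H`-extension of the Lie groupoid `𝒢`. The map `χ` from `P` to the band is smooth, in
the sense that `(p, g) ↦ χ p g` is smooth, and equivariant with respect to both actions. -/
structure Extension (C : CrossedModule.{u}) (𝒢 : LieGroupoid M) where
  ext : GExtension C.G 𝒢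
  bun : PrincipalBundle C.H ext.R
  χ : ∀ p : bun.P, Band ext (bun.π p)
  smooth_χ : ContMDiff ((𝓡 bun.P.dim).prod (𝓡 C.G.toMfd.dim)) (𝓡 ext.R.arr.dim) ∞
    fun x : bun.P × C.G => (χ x.1).toFun x.2
  χ_ract : ∀ p h g, (χ (bun.ract p h)).toFun g = (χ p).toFun (C.act h g)
  χ_lact : ∀ r p h g, (χ (bun.lact r p h)).toFun g = ext.R.conj r ((χ p).toFun g)
    (h.trans ((χ p).s_eq g).symm) (((χ p).t_eq g).trans h.symm)
  ract_ρ : ∀ p g, bun.ract p (C.ρ g) = bun.lact ((χ p).toFun g) p ((χ p).t_eq g)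

/-- Isomorphisms of `G → H`-extensions of `𝒢`: an isomorphism `Φ` of Lie groupoids over `𝒢` and a
diffeomorphism `Ψ` of the bundles, over the identity of `M`, equivariant and compatible with the
maps to the bands. -/
structure ExtIso {C : CrossedModule.{u}} {𝒢 : LieGroupoid M} (E E' : Extension C 𝒢) where
  Φ : Iso E.ext.R E'.ext.R
  φ_Φ : ∀ r, E'.ext.φ (Φ.toFun r) = E.ext.φ r
  Ψ : E.bun.P → E'.bun.P
  Ψinv : E'.bun.P → E.bun.P
  left_inv : ∀ p, Ψinv (Ψ p) = p
  right_inv : ∀ p, Ψ (Ψinv p) = p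
  smooth_Ψ : Smooth Ψ
  smooth_Ψinv : Smooth Ψinv
  π_Ψ : ∀ p, E'.bun.π (Ψ p) = E.bun.π p
  Ψ_ract : ∀ p h, Ψ (E.bun.ract p h) = E'.bun.ract (Ψ p) h
  Ψ_lact : ∀ r p h, Ψ (E.bun.lact r p h) =
    E'.bun.lact (Φ.toFun r) (Ψ p) ((Φ.mor.t_map r).trans (h.trans (π_Ψ p).symm))
  χ_Ψ : ∀ p g, (E'.χ (Ψ p)).toFun g = Φ.toFun ((E.χ p).toFun g)

section map

variable {𝒢 𝒢' : LieGroupoid M} (Θ : Iso 𝒢 𝒢')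

theorem Iso.surjSubm : SurjSubm Θ.toFun :=
  ⟨subm_of_hasSec Θ.mor.smooth fun x => ⟨Θ.invFun, Θ.mor_inv.smooth.contMDiffAt, Θ.left_inv x,
    Eventually.of_forall Θ.right_inv⟩, fun y => ⟨Θ.invFun y, Θ.right_inv y⟩⟩

theorem ker_map {R : LieGroupoid M} (φ : R.arr → 𝒢.arr) (m : M) :
    ker (fun r => Θ.toFun (φ r)) m = ker φ m := by
  ext r
  constructor
  · intro h
    have h' : Θ.toFun (φ r) = 𝒢'.one m := h
    change φ r = 𝒢.one m
    rw [← Θ.left_inv (φ r), h', Θ.mor_inv.map_one]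
  · intro h
    have h' : φ r = 𝒢.one m := h
    change Θ.toFun (φ r) = 𝒢'.one m
    rw [h', Θ.mor.map_one]

theorem IsKerIso.map {R : LieGroupoid M} {φ : R.arr → 𝒢.arr} {G : LieGrp.{u}} {m : M}
    {b : G → R.arr} (hb : IsKerIso φ m b) : IsKerIso (fun r => Θ.toFun (φ r)) m b where
  mem g := by rw [ker_map]; exact hb.mem g
  mul := hb.mul
  inj := hb.inj
  surj r hr := hb.surj r (by rwa [ker_map] at hr)

/-- The transport `(R, Θ ∘ φ)` of a `G`-extension `(R, φ)` along an isomorphism `Θ : 𝒢 ≅ 𝒢'`. -/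
noncomputable def GExtension.map {G : LieGrp.{u}} (E : GExtension G 𝒢) : GExtension G 𝒢' where
  R := E.R
  φ r := Θ.toFun (E.φ r)
  mor := Θ.mor.comp E.mor
  surjSubm := Θ.surjSubm.comp E.surjSubm
  locTriv x := by
    obtain ⟨U, τ, σ, h1, h2, h3, h4, h5⟩ := E.locTriv x
    refine ⟨U, τ, σ, h1, h2, h3, ?_, fun m hm => ⟨(h5 m hm).1.map Θ, (h5 m hm).2⟩⟩
    simpa only [ker_map] using h4

/-- The transport `(R, Θ ∘ φ, P, χ)` of a `G → H`-extension `(R, φ, P, χ)` along an isomorphism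
`Θ : 𝒢 ≅ 𝒢'`. -/
noncomputable def Extension.map {C : CrossedModule.{u}} (E : Extension C 𝒢) : Extension C 𝒢' where
  ext := E.ext.map Θ
  bun := E.bun
  χ p :=
    { toFun := (E.χ p).toFun
      iso := (E.χ p).iso.map Θ
      smooth := (E.χ p).smooth
      smooth_inv := by
        obtain ⟨σ, h1, h2⟩ := (E.χ p).smooth_inv
        refine ⟨σ, ?_, h2⟩
        change ContMDiffOn (𝓡 E.ext.R.arr.dim) (𝓡 C.G.toMfd.dim) ∞ σ
          (ker (fun r => Θ.toFun (E.ext.φ r)) _)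
        rw [ker_map]
        exact h1 }
  smooth_χ := E.smooth_χ
  χ_ract := E.χ_ract
  χ_lact := E.χ_lact
  ract_ρ := E.ract_ρ

end map

section pullback

variable {𝒢 : LieGroupoid M} (p : M' → M) (hp : SurjSubm p)

theorem surjSubm_pullbackMap {R : LieGroupoid M} {φ : R.arr → 𝒢.arr} (hφ : IsMorphism R 𝒢 φ)
    (h : SurjSubm φ) : SurjSubm (pullbackMap hφ p hp) := by
  refine ⟨subm_of_hasSec (isMorphism_pullbackMap hφ p hp).smooth fun z => ?_, fun y => ?_⟩
  · obtain ⟨σ, h1, h2, h3⟩ := h.subm.hasSec (PB.mid z)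
    set w : PB 𝒢 p hp := pullbackMap hφ p hp z with hw
    have hm := (PB.smooth_mid (𝒢 := 𝒢) hp).contMDiffAt (x := w)
    have h3' : ∀ᶠ y : PB 𝒢 p hp in 𝓝 w, φ (σ (PB.mid y)) = PB.mid y :=
      hm.continuousAt.eventually h3
    obtain ⟨c, c1, c2, c3, c4, c5⟩ := PB.exists_lift (𝒢 := R) hp (X := PB 𝒢 p hp)
      (a := PB.src) (b := PB.tgt) (γ := fun y => σ (PB.mid y)) (x := w)
      (PB.smooth_src (𝒢 := 𝒢) hp).contMDiffAt (ContMDiffAt.comp w h1 hm)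
      (PB.smooth_tgt (𝒢 := 𝒢) hp).contMDiffAt
      (h3'.mono fun y hy => by rw [← hφ.s_map, hy]; exact PB.ws y)
      (h3'.mono fun y hy => by rw [← hφ.t_map, hy]; exact PB.wt y)
    refine ⟨c, c1, PB.ext c2 (c3.trans h2) c4, ?_⟩
    filter_upwards [c5, h3'] with y hy hy'
    exact PB.ext hy.1 ((congrArg φ hy.2.1).trans hy') hy.2.2
  · obtain ⟨r, hr⟩ := h.surj (PB.mid y)
    exact ⟨PB.mk (PB.src y) r (PB.tgt y) ((PB.ws y).trans (by rw [← hr, hφ.s_map]))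
      ((by rw [← hr, hφ.t_map] : R.t r = 𝒢.t (PB.mid y)).trans (PB.wt y)), PB.ext rfl hr rfl⟩

theorem mem_ker_pullbackMap {R : LieGroupoid M} {φ : R.arr → 𝒢.arr} (hφ : IsMorphism R 𝒢 φ)
    (m : M') (z : (R.pullback p hp).arr) :
    z ∈ ker (R := R.pullback p hp) (𝒢 := 𝒢.pullback p hp) (pullbackMap hφ p hp) m ↔
      PB.src z = m ∧ PB.mid z ∈ ker φ (p m) ∧ PB.tgt z = m := by
  constructor
  · intro h
    have h' : pullbackMap hφ p hp z = (𝒢.pullback p hp).one m := h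
    exact ⟨congrArg PB.src h', congrArg PB.mid h', congrArg PB.tgt h'⟩
  · rintro ⟨h1, h2, h3⟩
    exact PB.ext h1 h2 h3

theorem IsKerIso.pullback {R : LieGroupoid M} {φ : R.arr → 𝒢.arr} (hφ : IsMorphism R 𝒢 φ)
    {G : LieGrp.{u}} {m : M'} {b : G → R.arr} (hb : IsKerIso φ (p m) b)
    (b' : G → (R.pullback p hp).arr) (h1 : ∀ g, PB.src (b' g) = m) (h2 : ∀ g, PB.mid (b' g) = b g)
    (h3 : ∀ g, PB.tgt (b' g) = m) :
    IsKerIso (R := R.pullback p hp) (𝒢 := 𝒢.pullback p hp) (pullbackMap hφ p hp) m b' where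
  mem g := (mem_ker_pullbackMap p hp hφ m _).2 ⟨h1 g, by rw [h2]; exact hb.mem g, h3 g⟩
  mul g g' := by
    refine ⟨(h3 g).trans (h1 g').symm, PB.ext ((h1 _).trans (h1 _).symm) ?_
      ((h3 _).trans (h3 _).symm)⟩
    obtain ⟨h, e⟩ := hb.mul g g'
    refine (h2 _).trans (e.trans ?_)
    change _ = R.mul (PB.mid (b' g)) (PB.mid (b' g')) _
    simp only [h2]
  inj g g' h := hb.inj (by rw [← h2, ← h2, h])
  surj r hr := by
    obtain ⟨k1, k2, k3⟩ := (mem_ker_pullbackMap p hp hφ m r).1 hr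
    obtain ⟨g, hg⟩ := hb.surj _ k2
    exact ⟨g, PB.ext ((h1 g).trans k1.symm) ((h2 g).trans hg) ((h3 g).trans k3.symm)⟩

open Classical in
/-- The pull-back `R[p] → 𝒢[p]` of a `G`-extension `R → 𝒢`. -/
noncomputable def GExtension.pullback {G : LieGrp.{u}} (E : GExtension G 𝒢) :
    GExtension G (𝒢.pullback p hp) where
  R := E.R.pullback p hp
  φ := pullbackMap E.mor p hp
  mor := isMorphism_pullbackMap E.mor p hp
  surjSubm := surjSubm_pullbackMap p hp E.mor E.surjSubm
  locTriv x := by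
    obtain ⟨U, τ, σ, hU, hx, hτ, hσ, h⟩ := E.locTriv (p x)
    have hs : ∀ m : M', p m ∈ U → ∀ g, p m = E.R.s (τ (p m) g) := fun m hm g =>
      (E.mor.s_of_ker ((h _ hm).1.mem g)).symm
    have ht : ∀ m : M', p m ∈ U → ∀ g, E.R.t (τ (p m) g) = p m := fun m hm g =>
      E.mor.t_of_ker ((h _ hm).1.mem g)
    set τ' : M' → G → (E.R.pullback p hp).arr := fun m g =>
      if hm : p m ∈ U then PB.mk m (τ (p m) g) m (hs m hm g) (ht m hm g)
      else (E.R.pullback p hp).one m with hτ'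
    have e : ∀ m (hm : p m ∈ U) g,
        τ' m g = PB.mk m (τ (p m) g) m (hs m hm g) (ht m hm g) := fun m hm g => dif_pos hm
    refine ⟨p ⁻¹' U, τ', fun z => σ (PB.mid z), hU.preimage hp.smooth.continuous, hx, ?_, ?_, ?_⟩
    · have hpz : ContMDiff ((𝓡 M'.dim).prod (𝓡 G.toMfd.dim)) ((𝓡 M.dim).prod (𝓡 G.toMfd.dim)) ∞
          fun z : M' × G => (p z.1, z.2) :=
        (hp.smooth.comp contMDiff_fst).prodMk contMDiff_snd
      have h2 := hτ.comp hpz.contMDiffOn (s := (p ⁻¹' U) ×ˢ univ) fun z hz => ⟨hz.1, trivial⟩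
      refine PB.contMDiffOn hp (contMDiff_fst.contMDiffOn.congr fun z hz => ?_) (h2.congr fun z hz => ?_)
        (contMDiff_fst.contMDiffOn.congr fun z hz => ?_)
      · rw [e _ hz.1]; rfl
      · rw [e _ hz.1]; rfl
      · rw [e _ hz.1]; rfl
    · refine hσ.comp (PB.smooth_mid (𝒢 := E.R) hp).contMDiffOn ?_
      rintro z ⟨m, hm, hz⟩
      exact ⟨p m, hm, ((mem_ker_pullbackMap p hp E.mor m z).1 hz).2.1⟩
    · intro m hm
      refine ⟨IsKerIso.pullback p hp E.mor (h _ hm).1 (τ' m) (fun g => ?_) (fun g => ?_)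
        (fun g => ?_), fun g => ?_⟩
      · rw [e _ hm]; rfl
      · rw [e _ hm]; rfl
      · rw [e _ hm]; rfl
      · rw [e _ hm]; exact (h _ hm).2 g

/-- The pull-back `P ×_M M'` of a principal bundle over `R`, as a principal bundle over `R[p]`. The
action is `(n, r, n') · (x, n') = (r · x, n)`. -/
noncomputable def PrincipalBundle.pullback {H : LieGrp.{u}} {R : LieGroupoid M}
    (Q : PrincipalBundle H R) : PrincipalBundle H (R.pullback p hp) where
  P := FP Q.π p Q.hπ.subm hp.smooth
  π := FP.snd
  hπ := FP.surjSubm_snd Q.hπ hp.smooth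
  ract z h := FP.mk (Q.ract (FP.fst z) h) (FP.snd z) ((Q.π_ract _ _).trans (FP.w z))
  smooth_ract := by
    have l1 := (FP.smooth_fst (hf := Q.hπ.subm) (hg := hp.smooth)).comp
      (contMDiff_fst (N := H) (J := 𝓡 H.toMfd.dim))
    have l2 := (FP.smooth_snd (hf := Q.hπ.subm) (hg := hp.smooth)).comp
      (contMDiff_fst (N := H) (J := 𝓡 H.toMfd.dim))
    exact FP.contMDiff_iff.2 ⟨Q.smooth_ract.comp (l1.prodMk contMDiff_snd), l2⟩
  π_ract _ _ := rfl
  ract_one z := FP.ext (Q.ract_one _) rfl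
  ract_mul z h h' := FP.ext (Q.ract_mul _ _ _) rfl
  locTriv x := by
    classical
    obtain ⟨U, s, δ, hU, hx, hs, hδ, h1, h2⟩ := Q.locTriv (p x)
    set s' : M' → FPSet Q.π p := fun m =>
      if hm : p m ∈ U then FP.mk (s (p m)) m (h1 _ hm).1
      else FP.mk (Q.hπ.surj (p m)).choose m (Q.hπ.surj (p m)).choose_spec with hs'
    have e : ∀ m (hm : p m ∈ U), s' m = FP.mk (s (p m)) m (h1 _ hm).1 := fun m hm => dif_pos hm
    refine ⟨p ⁻¹' U, s', fun z => δ (FP.fst z), hU.preimage hp.smooth.continuous, hx, ?_, ?_,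
      fun m hm => ?_, fun z hz => ?_⟩
    · refine FP.contMDiffOn_iff.2 ⟨?_, ?_⟩
      · exact (hs.comp hp.smooth.contMDiffOn fun m hm => hm).congr fun m hm => by
          rw [e m hm]; rfl
      · exact contMDiff_id.contMDiffOn.congr fun m hm => by rw [e m hm]; rfl
    · refine hδ.comp FP.smooth_fst.contMDiffOn fun z hz => ?_
      change Q.π (FP.fst z) ∈ U
      rw [FP.w z]
      exact hz
    · rw [e m hm]
      exact ⟨rfl, (h1 _ hm).2⟩
    · have hz' : p (FP.snd z) ∈ U := hz
      rw [e _ hz']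
      refine FP.ext ?_ rfl
      have := h2 (FP.fst z) (by rw [FP.w z]; exact hz')
      simp only [FP.w z] at this
      exact this
  lact r z h := FP.mk (Q.lact (PB.mid r) (FP.fst z)
      ((PB.wt r).trans ((congrArg p h).trans (FP.w z).symm))) (PB.src r)
    ((Q.π_lact _ _ _).trans (PB.ws r).symm)
  smooth_lact := by
    have k1 := PB.surjSubm_tgt (𝒢 := R) hp
    have k2 := FP.surjSubm_snd Q.hπ hp.smooth
    have l1 := FP.smooth_fst (hf := k1.subm) (hg := k2.smooth)
    have l2 := FP.smooth_snd (hf := k1.subm) (hg := k2.smooth)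
    refine FP.contMDiff_iff.2 ⟨?_, (PB.smooth_src (𝒢 := R) hp).comp l1⟩
    exact Q.smooth_lact.comp (FP.contMDiff_iff.2
      ⟨(PB.smooth_mid (𝒢 := R) hp).comp l1,
        (FP.smooth_fst (hf := Q.hπ.subm) (hg := hp.smooth)).comp l2⟩ :
      Smooth (M := FP (M := PB R p hp) (N := FP Q.π p Q.hπ.subm hp.smooth) PB.tgt FP.snd
        k1.subm k2.smooth) (N := FP R.t Q.π R.ht.subm Q.hπ.smooth)
      fun z => FP.mk (PB.mid (FP.fst z)) (FP.fst (FP.snd z))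
        ((PB.wt _).trans ((congrArg p (FP.w z)).trans (FP.w (FP.snd z)).symm)))
  π_lact _ _ _ := rfl
  one_lact z := by
    refine FP.ext ?_ rfl
    have := Q.one_lact (FP.fst z)
    simp only [FP.w z] at this
    exact this
  mul_lact r r' z h h' := FP.ext (Q.mul_lact _ _ _ _ _) rfl
  lact_ract r z h k := FP.ext (Q.lact_ract _ _ _ _) rfl

/-- The isomorphism `g ↦ (m', b g, m')` from `G` onto the fibre over `m'` of the kernel of the
pulled back extension, where `b` is an isomorphism onto the fibre over `p m'`. -/
noncomputable def Band.pullback {G : LieGrp.{u}} {E : GExtension G 𝒢} {m : M} {m' : M'}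
    (b : Band E m) (h : m = p m') : Band (E.pullback p hp) m' where
  toFun g := PB.mk m' (b.toFun g) m' (h.symm.trans (b.s_eq g).symm) ((b.t_eq g).trans h)
  iso := by
    subst h
    exact IsKerIso.pullback p hp E.mor b.iso _ (fun _ => rfl) (fun _ => rfl) (fun _ => rfl)
  smooth := PB.contMDiff hp contMDiff_const b.smooth contMDiff_const
  smooth_inv := by
    subst h
    obtain ⟨σ, h1, h2⟩ := b.smooth_inv
    exact ⟨fun r => σ (PB.mid r), h1.comp (PB.smooth_mid (𝒢 := E.R) hp).contMDiffOn
      fun r hr => ((mem_ker_pullbackMap p hp E.mor _ r).1 hr).2.1, h2⟩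

/-- The pull-back `(R[p], P ×_M M', χ[p])` of a `G → H`-extension. -/
noncomputable def Extension.pullback {C : CrossedModule.{u}} (E : Extension C 𝒢) :
    Extension C (𝒢.pullback p hp) where
  ext := E.ext.pullback p hp
  bun := E.bun.pullback p hp
  χ := fun z : FPSet E.bun.π p => (E.χ (FP.fst z)).pullback p hp (FP.w z)
  smooth_χ := by
    have l := (FP.smooth_snd (hf := E.bun.hπ.subm) (hg := hp.smooth)).comp
      (contMDiff_fst (N := C.G) (J := 𝓡 C.G.toMfd.dim))
    refine PB.contMDiff hp l ?_ l
    exact E.smooth_χ.comp (((FP.smooth_fst (hf := E.bun.hπ.subm) (hg := hp.smooth)).comp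
      contMDiff_fst).prodMk contMDiff_snd)
  χ_ract z h g := PB.ext rfl (E.χ_ract _ _ _) rfl
  χ_lact r z h g := PB.ext rfl (E.χ_lact _ _ _ _) rfl
  ract_ρ z g := FP.ext (E.ract_ρ _ _) rfl

end pullback

end LieGroupoid
namespace LieGroupoid

/-- A `G → H`-extension over `B ⇉ B₀`: a surjective submersion `q : M → B₀` and a
`G → H`-extension of the pull-back groupoid `B[q] ⇉ M`. -/
structure ExtOver (C : CrossedModule.{u}) {B₀ : Mfd.{u}} (B : LieGroupoid B₀) where
  M : Mfd.{u}
  q : M → B₀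
  hq : SurjSubm q
  ext : Extension C (B.pullback q hq)

/-- The pull-back of a `G → H`-extension over `B` along `p : M' → M`, with base map `q ∘ p`, by
means of `B[q][p] ≅ B[q ∘ p]`. -/
noncomputable def ExtOver.pullback {C : CrossedModule.{u}} {B₀ : Mfd.{u}} {B : LieGroupoid B₀}
    (E : ExtOver C B) {M' : Mfd.{u}} (p : M' → E.M) (hp : SurjSubm p) : ExtOver C B where
  M := M'
  q x := E.q (p x)
  hq := E.hq.comp hp
  ext := (E.ext.pullback p hp).map (pullbackComp B E.q E.hq p hp)

/-- Morita equivalence of `G → H`-extensions over `B`: there are surjective submersions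
`p : M'' → M` and `p' : M'' → M'` with `q ∘ p = q' ∘ p'` such that the pull-backs along `p` and
`p'` are isomorphic extensions of `B[q ∘ p] = B[q' ∘ p']`. -/
def MoritaEq {C : CrossedModule.{u}} {B₀ : Mfd.{u}} {B : LieGroupoid B₀} (E E' : ExtOver C B) :
    Prop :=
  ∃ (M'' : Mfd.{u}) (p : M'' → E.M) (p' : M'' → E'.M) (hp : SurjSubm p) (hp' : SurjSubm p')
    (h : ∀ x, E.q (p x) = E'.q (p' x)),
    Nonempty (ExtIso
      ((E.pullback p hp).ext.map (pullbackCongr B (E.hq.comp hp) (E'.hq.comp hp') h))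
      (E'.pullback p' hp').ext)

/-- A `G → H`-gerbe over `B ⇉ B₀`: a Morita equivalence class of `G → H`-extensions over `B`. -/
def Gerbe (C : CrossedModule.{u}) {B₀ : Mfd.{u}} (B : LieGroupoid B₀) : Type (u + 1) :=
  Quot (MoritaEq (C := C) (B := B))

/-- The gerbe represented by an extension. -/
def Gerbe.mk {C : CrossedModule.{u}} {B₀ : Mfd.{u}} {B : LieGroupoid B₀} (E : ExtOver C B) :
    Gerbe C B :=
  Quot.mk _ E

/-- A Morita equivalence `(T, f, g, Φ)` of Lie groupoids: surjective submersions `f : T → B₀` and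
`g : T → B₀'` and an isomorphism `Φ : B[f] ≅ B'[g]` of Lie groupoids over the identity of `T`. -/
structure MoritaEquiv {B₀ B₀' : Mfd.{u}} (B : LieGroupoid B₀) (B' : LieGroupoid B₀') where
  T : Mfd.{u}
  f : T → B₀
  g : T → B₀'
  hf : SurjSubm f
  hg : SurjSubm g
  Φ : Iso (B.pullback f hf) (B'.pullback g hg)

namespace MoritaEquiv

variable {B₀ B₀' : Mfd.{u}} {B : LieGroupoid B₀} {B' : LieGroupoid B₀'}

/-- The inverse Morita equivalence `(T, g, f, Φ⁻¹)`. -/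
noncomputable def symm (𝓜 : MoritaEquiv B B') : MoritaEquiv B' B :=
  ⟨𝓜.T, 𝓜.g, 𝓜.f, 𝓜.hg, 𝓜.hf, 𝓜.Φ.symm⟩

section

variable (𝓜 : MoritaEquiv B B') {M : Mfd.{u}} (q : M → B₀) (hq : SurjSubm q)

/-- The manifold `M ×_{B₀} T`. -/
noncomputable def base : Mfd.{u} := FP q 𝓜.f hq.subm 𝓜.hf.smooth

/-- The projection `α : M ×_{B₀} T → M`. -/
noncomputable def α : 𝓜.base q hq → M := fun z : FPSet q 𝓜.f => FP.fst z

/-- The projection `β : M ×_{B₀} T → T`. -/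
noncomputable def β : 𝓜.base q hq → 𝓜.T := fun z : FPSet q 𝓜.f => FP.snd z

theorem surjSubm_α : SurjSubm (𝓜.α q hq) := FP.surjSubm_fst hq.subm 𝓜.hf

theorem surjSubm_β : SurjSubm (𝓜.β q hq) := FP.surjSubm_snd hq 𝓜.hf.smooth

/-- The isomorphism `B[q][α] ≅ B[q ∘ α] = B[f ∘ β] ≅ B[f][β] ≅ B'[g][β] ≅ B'[g ∘ β]` induced
by `Φ`, which maps `(x, (α x, b, α y), y)` to `(x, b', y)` with `Φ (β x, b, β y) = (β x, b', β y)`.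
-/
noncomputable def baseIso : Iso ((B.pullback q hq).pullback (𝓜.α q hq) (𝓜.surjSubm_α q hq))
    (B'.pullback (fun x => 𝓜.g (𝓜.β q hq x)) (𝓜.hg.comp (𝓜.surjSubm_β q hq))) :=
  (pullbackComp B q hq (𝓜.α q hq) (𝓜.surjSubm_α q hq)).trans <|
  (pullbackCongr B (hq.comp (𝓜.surjSubm_α q hq)) (𝓜.hf.comp (𝓜.surjSubm_β q hq))
    (fun z : FPSet q 𝓜.f => FP.w z)).trans <|
  (pullbackComp B 𝓜.f 𝓜.hf (𝓜.β q hq) (𝓜.surjSubm_β q hq)).symm.trans <|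
  (𝓜.Φ.pullback (𝓜.β q hq) (𝓜.surjSubm_β q hq)).trans <|
  pullbackComp B' 𝓜.g 𝓜.hg (𝓜.β q hq) (𝓜.surjSubm_β q hq)

end

/-- The `G → H`-extension over `B'` induced by a `G → H`-extension over `B` and a Morita
equivalence: the pull-back to `M ×_{B₀} T`, with base map `g ∘ β`. -/
noncomputable def transport (𝓜 : MoritaEquiv B B') {C : CrossedModule.{u}} (E : ExtOver C B) :
    ExtOver C B' where
  M := 𝓜.base E.q E.hq
  q x := 𝓜.g (𝓜.β E.q E.hq x)
  hq := 𝓜.hg.comp (𝓜.surjSubm_β E.q E.hq)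
  ext := (E.ext.pullback (𝓜.α E.q E.hq) (𝓜.surjSubm_α E.q E.hq)).map (𝓜.baseIso E.q E.hq)

/-- The defining property of `baseIso`. -/
theorem baseIso_apply (𝓜 : MoritaEquiv B B') {M : Mfd.{u}} (q : M → B₀) (hq : SurjSubm q)
    (z : ((B.pullback q hq).pullback (𝓜.α q hq) (𝓜.surjSubm_α q hq)).arr)
    (h : 𝓜.f (𝓜.β q hq (PB.src z)) = B.s (PB.mid (PB.mid z)))
    (h' : B.t (PB.mid (PB.mid z)) = 𝓜.f (𝓜.β q hq (PB.tgt z))) :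
    PB.src ((𝓜.baseIso q hq).toFun z) = PB.src z ∧ PB.tgt ((𝓜.baseIso q hq).toFun z) = PB.tgt z ∧
      PB.mid ((𝓜.baseIso q hq).toFun z) = PB.mid (𝓜.Φ.toFun
        (PB.mk (𝓜.β q hq (PB.src z)) (PB.mid (PB.mid z)) (𝓜.β q hq (PB.tgt z)) h h')) :=
  ⟨rfl, rfl, rfl⟩

end MoritaEquiv

end LieGroupoid

/-! Transport respects Morita equivalence, and transporting along `𝓜` and then along `𝓜.symm`
returns to the original class. Applying the second fact to `𝓜.symm` as well gives a two-sided
inverse, hence the bijection.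

Well-definedness. For a surjective submersion `p : M' → E.M`, base change gives a surjective
submersion from `M' ×_{B₀} T` to `M ×_{B₀} T`. Pulling the transport of `E` back along it gives the
transport of the pull-back of `E`, up to canonical identifications (`moritaEq_transport_pullback`).
Since isomorphic extensions have Morita equivalent transports (`moritaEq_transport`), a Morita
equivalence between `E` and `E'` yields a chain of three equalities of gerbes.

Inverse. The double transport lives over triples `(m, t, t')` with `q m = f t` and `g t = g t'`. It
is the pull-back of `E` along `m`, but its base map is `f t'`, not `q m`. Add a point `n` of `M`
with `q n = f t'`; the pull-backs of `E` along `m` and along `n` must be compared. The maps `q m`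
and `q n` need not agree, but `Φ⁻¹` of the unit arrow `(t, 1, t')` of `B'[g]` gives an arrow of `B`
from `f t = q m` to `f t' = q n`, hence an arrow `c` of `B[q]` from `m` to `n`. Lift `c` to an arrow
`γ` of `R`. Conjugation by `γ` on `R` and the action of `γ⁻¹` on `P` form an isomorphism between the
two pull-backs (`ExtIso.conj`). The lift need not exist globally, but `φ` is a surjective
submersion, so one exists tautologically after pulling back along the surjective submersion `R
×_{B[q]} Y → Y`, which Morita equivalence allows.

It remains to see that this isomorphism covers the right identification of base groupoids. That is
`invFun_mk_eq_conj`: changing the end points of an arrow of `B'[g]` within the fibres of `g`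
corresponds under `Φ⁻¹` to conjugation by the link arrows in `B[f]`.

Throughout, iterated pull-backs and transports are reduced to the form `(E.pullback a ha).map Λ`:
one pull-back of `E`, with all identifications of groupoids collected in `Λ`. Comparing two such
extensions then amounts to comparing arrows of the base groupoid. -/

namespace LieGroupoid

/-! ### Calculus with arrows of a Lie groupoid. -/

variable {M N : Mfd.{u}}

/-- Composability is assumed in the form in which it occurs in the left-hand side, so that the
identity can be used as a rewriting rule. The unit laws below allow a unit at an arbitrary object
for the same reason. -/
theorem mul_assoc_of_comp (R : LieGroupoid M) (x y z : R.arr) (h : R.t x = R.s y)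
    (h' : R.t (R.mul x y h) = R.s z) :
    R.mul (R.mul x y h) z h' = R.mul x (R.mul y z ((R.t_mul x y h).symm.trans h'))
      (h.trans (R.s_mul y z _).symm) :=
  R.mul_assoc x y z h _

theorem one_mul_of_comp (R : LieGroupoid M) (m : M) (x : R.arr) (h : R.t (R.one m) = R.s x) :
    R.mul (R.one m) x h = x := by
  obtain rfl : m = R.s x := (R.t_one m).symm.trans h
  exact R.one_mul x

theorem mul_one_of_comp (R : LieGroupoid M) (m : M) (x : R.arr) (h : R.t x = R.s (R.one m)) :
    R.mul x (R.one m) h = x := by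
  obtain rfl : R.t x = m := h.trans (R.s_one m)
  exact R.mul_one x

theorem inv_mul_cancel_left (R : LieGroupoid M) (x y : R.arr) (h : R.t x = R.s y)
    (h' : R.t (R.inv x) = R.s (R.mul x y h)) : R.mul (R.inv x) (R.mul x y h) h' = y := by
  rw [← R.mul_assoc (R.inv x) x y (R.t_inv x) h]
  simp only [R.inv_mul, one_mul_of_comp]

theorem mul_inv_cancel_left (R : LieGroupoid M) (x y : R.arr) (h : R.t (R.inv x) = R.s y)
    (h' : R.t x = R.s (R.mul (R.inv x) y h)) : R.mul x (R.mul (R.inv x) y h) h' = y := by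
  rw [← R.mul_assoc x (R.inv x) y (R.s_inv x).symm h]
  simp only [R.mul_inv, one_mul_of_comp]

theorem eq_inv_of_mul_eq_one (R : LieGroupoid M) (x y : R.arr) (h : R.t x = R.s y)
    (e : R.mul x y h = R.one (R.s x)) : y = R.inv x := by
  have := R.inv_mul_cancel_left x y h ((R.t_inv x).trans (R.s_mul x y h).symm)
  rw [← this]
  simp only [e, mul_one_of_comp]

theorem inv_inv (R : LieGroupoid M) (x : R.arr) : R.inv (R.inv x) = x :=
  (R.eq_inv_of_mul_eq_one (R.inv x) x (R.t_inv x) (by rw [R.inv_mul, R.s_inv])).symm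

/-- Inserting `v v⁻¹` between `x` and `y` is what makes conjugation multiplicative. The arrows `v`
and `v'` are kept apart because in the application they are `γ` at the target of one arrow and at
the source of the next, which agree only through the composability equation. -/
theorem mul_mul_cancel_middle (R : LieGroupoid M) (u x y v v' w : R.arr) (e : v = v')
    (h1 : R.t x = R.s y) (h2 : R.t u = R.s (R.mul x y h1))
    (h3 : R.t (R.mul u (R.mul x y h1) h2) = R.s w) (h4 : R.t u = R.s x)
    (h5 : R.t (R.mul u x h4) = R.s v) (h6 : R.t (R.inv v') = R.s y)
    (h7 : R.t (R.mul (R.inv v') y h6) = R.s w)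
    (h8 : R.t (R.mul (R.mul u x h4) v h5) = R.s (R.mul (R.mul (R.inv v') y h6) w h7)) :
    R.mul (R.mul u (R.mul x y h1) h2) w h3 =
      R.mul (R.mul (R.mul u x h4) v h5) (R.mul (R.mul (R.inv v') y h6) w h7) h8 := by
  subst e
  simp only [mul_assoc_of_comp, mul_inv_cancel_left]

theorem IsMorphism.map_inv {R S : LieGroupoid M} {φ : R.arr → S.arr} (hφ : IsMorphism R S φ)
    (x : R.arr) : φ (R.inv x) = S.inv (φ x) := by
  refine S.eq_inv_of_mul_eq_one _ _
    ((hφ.t_map x).trans ((R.s_inv x).symm.trans (hφ.s_map _).symm)) ?_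
  rw [← hφ.map_mul x (R.inv x) (R.s_inv x).symm, R.mul_inv, hφ.map_one, hφ.s_map]

/-- The product of composable smooth families of arrows is smooth. -/
theorem smooth_mul_of_smooth (R : LieGroupoid M) {X : Mfd.{u}} {c d : X → R.arr} (hc : Smooth c)
    (hd : Smooth d) (h : ∀ x, R.t (c x) = R.s (d x)) : Smooth fun x => R.mul (c x) (d x) (h x) :=
  R.smooth_mul.comp (FP.contMDiff_iff.2 ⟨hc, hd⟩ :
    Smooth (N := FP R.t R.s R.ht.subm R.hs.smooth) fun x => FP.mk (c x) (d x) (h x))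

/-- The identity isomorphism. -/
noncomputable def Iso.refl (R : LieGroupoid M) : Iso R R :=
  ⟨id, id, fun _ => rfl, fun _ => rfl, ⟨contMDiff_id, fun _ => rfl, fun _ => rfl, fun _ _ _ => rfl⟩,
    ⟨contMDiff_id, fun _ => rfl, fun _ => rfl, fun _ _ _ => rfl⟩⟩

/-! ### Conjugation by a smooth family of arrows. -/

section conj

variable (R : LieGroupoid M) {a b : N → M} (ha : SurjSubm a) (hb : SurjSubm b) {γ : N → R.arr}
  (hs : ∀ x, R.s (γ x) = a x) (ht : ∀ x, R.t (γ x) = b x)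

/-- The map `(x, r, y) ↦ (x, (γ x)⁻¹ r (γ y), y)` from `R[a]` to `R[b]`, where `γ x` is an arrow
from `a x` to `b x`. -/
noncomputable def conjFun (z : (R.pullback a ha).arr) : (R.pullback b hb).arr :=
  PB.mk (PB.src z) (R.mul (R.mul (R.inv (γ (PB.src z))) (PB.mid z)
      ((R.t_inv _).trans ((hs _).trans (PB.ws z)))) (γ (PB.tgt z))
      ((R.t_mul _ _ _).trans ((PB.wt z).trans (hs _).symm))) (PB.tgt z)
    ((ht _).symm.trans ((R.s_inv _).symm.trans ((R.s_mul _ _ _).symm.trans (R.s_mul _ _ _).symm)))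
    ((R.t_mul _ _ _).trans (ht _))

/-- The end point conditions depend on the family, so it can only be exchanged together with them.
This serves to replace `φ ∘ γ` by the family of arrows that `γ` lifts. -/
theorem conjFun_congr {δ : N → R.arr} (hs' : ∀ x, R.s (δ x) = a x) (ht' : ∀ x, R.t (δ x) = b x)
    (e : ∀ x, γ x = δ x) (z : (R.pullback a ha).arr) :
    R.conjFun ha hb hs ht z = R.conjFun ha hb hs' ht' z := by
  obtain rfl : γ = δ := funext e
  rfl

theorem isMorphism_conjFun (hγ : Smooth γ) :
    IsMorphism (R.pullback a ha) (R.pullback b hb) (R.conjFun ha hb hs ht) where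
  smooth := by
    refine PB.contMDiff hb (PB.smooth_src ha) ?_ (PB.smooth_tgt ha)
    exact R.smooth_mul_of_smooth (R.smooth_mul_of_smooth
      (R.smooth_inv.comp (hγ.comp (PB.smooth_src ha))) (PB.smooth_mid ha) _)
      (hγ.comp (PB.smooth_tgt ha)) _
  s_map _ := rfl
  t_map _ := rfl
  map_mul x y h := by
    have h : PB.tgt x = PB.src y := h
    exact PB.ext rfl (R.mul_mul_cancel_middle _ _ _ _ _ _ (congrArg γ h) _ _ _ _ _ _ _ _) rfl

/-- With `δ` only propositionally equal to `γ⁻¹`, one statement yields both inverse laws of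
`conjIso`: the second is the case of the family `γ⁻¹`, whose inverse is `γ`. -/
theorem conjFun_conjFun {δ : N → R.arr} (hs' : ∀ x, R.s (δ x) = b x)
    (ht' : ∀ x, R.t (δ x) = a x) (e : ∀ x, δ x = R.inv (γ x)) (z : (R.pullback a ha).arr) :
    R.conjFun hb ha hs' ht' (R.conjFun ha hb hs ht z) = z := by
  obtain rfl : δ = fun x => R.inv (γ x) := funext e
  refine PB.ext rfl ?_ rfl
  change R.mul (R.mul (R.inv (R.inv (γ (PB.src z)))) (R.mul (R.mul (R.inv (γ (PB.src z)))
    (PB.mid z) _) (γ (PB.tgt z)) _) _) (R.inv (γ (PB.tgt z))) _ = PB.mid z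
  simp only [mul_assoc_of_comp, inv_inv, R.mul_inv, mul_one_of_comp, mul_inv_cancel_left]

/-- The isomorphism `(x, r, y) ↦ (x, (γ x)⁻¹ r (γ y), y)` from `R[a]` to `R[b]`, where `γ x` is an
arrow from `a x` to `b x`. -/
noncomputable def conjIso (hγ : Smooth γ) : Iso (R.pullback a ha) (R.pullback b hb) where
  toFun := R.conjFun ha hb hs ht
  invFun := R.conjFun (γ := fun x => R.inv (γ x)) hb ha (fun x => (R.s_inv _).trans (ht x))
    (fun x => (R.t_inv _).trans (hs x))
  left_inv := R.conjFun_conjFun ha hb hs ht _ _ fun _ => rfl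
  right_inv := R.conjFun_conjFun hb ha _ _ hs ht fun _ => (R.inv_inv _).symm
  mor := R.isMorphism_conjFun ha hb hs ht hγ
  mor_inv := R.isMorphism_conjFun hb ha _ _ (R.smooth_inv.comp hγ)

/-- A morphism preserves products and inverses, so conjugation by `γ` covers conjugation by `φ ∘ γ`.
-/
theorem conjFun_pullbackMap {S : LieGroupoid M} {φ : R.arr → S.arr} (hφ : IsMorphism R S φ)
    (hs' : ∀ x, S.s (φ (γ x)) = a x) (ht' : ∀ x, S.t (φ (γ x)) = b x)
    (z : (R.pullback a ha).arr) :
    pullbackMap hφ b hb (R.conjFun ha hb hs ht z) =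
      S.conjFun (γ := fun x => φ (γ x)) ha hb hs' ht' (pullbackMap hφ a ha z) := by
  refine PB.ext rfl ?_ rfl
  change φ (R.mul (R.mul (R.inv (γ (PB.src z))) (PB.mid z) _) (γ (PB.tgt z)) _) =
    S.mul (S.mul (S.inv (φ (γ (PB.src z)))) (φ (PB.mid z)) _) (φ (γ (PB.tgt z))) _
  simp only [hφ.map_mul, hφ.map_inv]

end conj

/-! ### Calculus with the action of arrows on a principal bundle. -/

namespace PrincipalBundle

variable {H : LieGrp.{u}} {R : LieGroupoid M} (Q : PrincipalBundle H R)

theorem lact_congr {r r' : R.arr} {p p' : Q.P} (h : R.t r = Q.π p) (hr : r = r') (hp : p = p')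
    (h' : R.t r' = Q.π p') : Q.lact r p h = Q.lact r' p' h' := by
  subst hr hp; rfl

theorem one_lact_of_comp (m : M) (p : Q.P) (h : R.t (R.one m) = Q.π p) :
    Q.lact (R.one m) p h = p := by
  obtain rfl : m = Q.π p := (R.t_one m).symm.trans h
  exact Q.one_lact p

theorem lact_lact (r r' : R.arr) (p : Q.P) (h' : R.t r' = Q.π p)
    (h : R.t r = Q.π (Q.lact r' p h')) :
    Q.lact r (Q.lact r' p h') h = Q.lact (R.mul r r' (h.trans (Q.π_lact _ _ _))) p
      ((R.t_mul _ _ _).trans h') :=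
  (Q.mul_lact r r' p (h.trans (Q.π_lact _ _ _)) h').symm

theorem lact_inv_lact (r : R.arr) (p : Q.P) (h : R.t r = Q.π p)
    (h' : R.t (R.inv r) = Q.π (Q.lact r p h)) : Q.lact (R.inv r) (Q.lact r p h) h' = p := by
  simp only [lact_lact, R.inv_mul, one_lact_of_comp]

theorem lact_lact_inv (r : R.arr) (p : Q.P) (h : R.t (R.inv r) = Q.π p)
    (h' : R.t r = Q.π (Q.lact (R.inv r) p h)) : Q.lact r (Q.lact (R.inv r) p h) h' = p := by
  simp only [lact_lact, R.mul_inv, one_lact_of_comp]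

/-- The analogue of `mul_mul_cancel_middle` for the action: with `u` and `v` inverse values of `γ`
and values of `γ`, it says that acting by `γ⁻¹` intertwines `r` with its conjugate. -/
theorem lact_lact_cancel_middle (u r v v' : R.arr) (p : Q.P) (e : v = v') (h1 : R.t r = Q.π p)
    (h2 : R.t u = Q.π (Q.lact r p h1)) (h3 : R.t u = R.s r) (h4 : R.t (R.mul u r h3) = R.s v)
    (h5 : R.t (R.inv v') = Q.π p)
    (h6 : R.t (R.mul (R.mul u r h3) v h4) = Q.π (Q.lact (R.inv v') p h5)) :
    Q.lact u (Q.lact r p h1) h2 =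
      Q.lact (R.mul (R.mul u r h3) v h4) (Q.lact (R.inv v') p h5) h6 := by
  subst e
  simp only [lact_lact, mul_assoc_of_comp, R.mul_inv, mul_one_of_comp]

/-- The action of a smooth family of arrows on a smooth family of points is smooth. -/
theorem smooth_lact_of_smooth {X : Mfd.{u}} {c : X → R.arr} {d : X → Q.P} (hc : Smooth c)
    (hd : Smooth d) (h : ∀ x, R.t (c x) = Q.π (d x)) :
    Smooth fun x => Q.lact (c x) (d x) (h x) :=
  Q.smooth_lact.comp (FP.contMDiff_iff.2 ⟨hc, hd⟩ :
    Smooth (N := FP R.t Q.π R.ht.subm Q.hπ.smooth) fun x => FP.mk (c x) (d x) (h x))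

end PrincipalBundle

/-! ### Isomorphisms of extensions: groupoid laws, functoriality and conjugation. -/

namespace ExtIso

variable {C : CrossedModule.{u}} {𝒢 𝒢' : LieGroupoid M} {E E' E'' : Extension C 𝒢}

/-- The identity isomorphism. -/
noncomputable def refl (E : Extension C 𝒢) : ExtIso E E where
  Φ := Iso.refl _
  φ_Φ _ := rfl
  Ψ := id
  Ψinv := id
  left_inv _ := rfl
  right_inv _ := rfl
  smooth_Ψ := contMDiff_id
  smooth_Ψinv := contMDiff_id
  π_Ψ _ := rfl
  Ψ_ract _ _ := rfl
  Ψ_lact _ _ _ := rfl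
  χ_Ψ _ _ := rfl

/-- The inverse isomorphism. -/
noncomputable def symm (I : ExtIso E E') : ExtIso E' E where
  Φ := I.Φ.symm
  φ_Φ r := by
    rw [← I.φ_Φ]
    exact congrArg _ (I.Φ.right_inv r)
  Ψ := I.Ψinv
  Ψinv := I.Ψ
  left_inv := I.right_inv
  right_inv := I.left_inv
  smooth_Ψ := I.smooth_Ψinv
  smooth_Ψinv := I.smooth_Ψ
  π_Ψ p := by rw [← I.π_Ψ, I.right_inv]
  Ψ_ract p h := by
    conv_lhs => rw [← I.right_inv p, ← I.Ψ_ract, I.left_inv]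
  Ψ_lact r p h := by
    -- `I.Ψ` is injective, so it suffices to compare images, where its own equivariance applies.
    refine (Function.LeftInverse.injective I.left_inv) ?_
    rw [I.right_inv, I.Ψ_lact]
    exact E'.bun.lact_congr _ (I.Φ.right_inv r).symm (I.right_inv p).symm _
  χ_Ψ p g := by
    have := I.χ_Ψ (I.Ψinv p) g
    rw [I.right_inv] at this
    rw [this]
    exact (I.Φ.left_inv _).symm

/-- Composition of isomorphisms. -/
noncomputable def trans (I : ExtIso E E') (J : ExtIso E' E'') : ExtIso E E'' where
  Φ := I.Φ.trans J.Φ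
  φ_Φ r := (J.φ_Φ _).trans (I.φ_Φ r)
  Ψ p := J.Ψ (I.Ψ p)
  Ψinv p := I.Ψinv (J.Ψinv p)
  left_inv p := by rw [J.left_inv, I.left_inv]
  right_inv p := by rw [I.right_inv, J.right_inv]
  smooth_Ψ := J.smooth_Ψ.comp I.smooth_Ψ
  smooth_Ψinv := I.smooth_Ψinv.comp J.smooth_Ψinv
  π_Ψ p := (J.π_Ψ _).trans (I.π_Ψ p)
  Ψ_ract p h := by rw [I.Ψ_ract, J.Ψ_ract]
  Ψ_lact r p h := by rw [I.Ψ_lact, J.Ψ_lact]; rfl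
  χ_Ψ p g := by rw [J.χ_Ψ, I.χ_Ψ]; rfl

/-- Transport of an isomorphism of extensions along an isomorphism of groupoids. -/
noncomputable def map (I : ExtIso E E') (Θ : Iso 𝒢 𝒢') : ExtIso (E.map Θ) (E'.map Θ) where
  Φ := I.Φ
  φ_Φ r := congrArg Θ.toFun (I.φ_Φ r)
  Ψ := I.Ψ
  Ψinv := I.Ψinv
  left_inv := I.left_inv
  right_inv := I.right_inv
  smooth_Ψ := I.smooth_Ψ
  smooth_Ψinv := I.smooth_Ψinv
  π_Ψ := I.π_Ψ
  Ψ_ract := I.Ψ_ract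
  Ψ_lact := I.Ψ_lact
  χ_Ψ := I.χ_Ψ

/-- The identity, as an isomorphism between transports along isomorphisms with the same underlying
map. -/
noncomputable def mapCongr (E : Extension C 𝒢) {Θ Θ' : Iso 𝒢 𝒢'}
    (h : ∀ x, Θ'.toFun x = Θ.toFun x) : ExtIso (E.map Θ) (E.map Θ') where
  Φ := Iso.refl _
  φ_Φ _ := h _
  Ψ := id
  Ψinv := id
  left_inv _ := rfl
  right_inv _ := rfl
  smooth_Ψ := contMDiff_id
  smooth_Ψinv := contMDiff_id
  π_Ψ _ := rfl
  Ψ_ract _ _ := rfl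
  Ψ_lact _ _ _ := rfl
  χ_Ψ _ _ := rfl

/-- Pull-back of an isomorphism of extensions. -/
noncomputable def pullback (I : ExtIso E E') (p : N → M) (hp : SurjSubm p) :
    ExtIso (E.pullback p hp) (E'.pullback p hp) where
  Φ := I.Φ.pullback p hp
  φ_Φ _ := PB.ext rfl (I.φ_Φ _) rfl
  Ψ z := FP.mk (I.Ψ (FP.fst z)) (FP.snd z) ((I.π_Ψ _).trans (FP.w z))
  Ψinv z := FP.mk (I.Ψinv (FP.fst z)) (FP.snd z) ((I.symm.π_Ψ _).trans (FP.w z))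
  left_inv _ := FP.ext (I.left_inv _) rfl
  right_inv _ := FP.ext (I.right_inv _) rfl
  smooth_Ψ := FP.contMDiff_iff.2 ⟨I.smooth_Ψ.comp FP.smooth_fst, FP.smooth_snd⟩
  smooth_Ψinv := FP.contMDiff_iff.2 ⟨I.smooth_Ψinv.comp FP.smooth_fst, FP.smooth_snd⟩
  π_Ψ _ := rfl
  Ψ_ract _ _ := FP.ext (I.Ψ_ract _ _) rfl
  Ψ_lact _ _ _ := FP.ext (I.Ψ_lact _ _ _) rfl
  χ_Ψ _ _ := PB.ext rfl (I.χ_Ψ _ _) rfl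

/-- The canonical isomorphism `E[a][b] ≅ E[a ∘ b]`, up to the identification of the base
groupoids, for an extension `E[a]` that has been transported along `Λ`. -/
noncomputable def pullbackMapPullback {K : Mfd.{u}} (E : Extension C 𝒢) (a : N → M)
    (ha : SurjSubm a) {𝓗 : LieGroupoid N} (Λ : Iso (𝒢.pullback a ha) 𝓗) (b : K → N)
    (hb : SurjSubm b) : ExtIso (((E.pullback a ha).map Λ).pullback b hb)
      ((E.pullback (fun x => a (b x)) (ha.comp hb)).map
        ((pullbackComp 𝒢 a ha b hb).symm.trans (Λ.pullback b hb))) where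
  Φ := pullbackComp E.ext.R a ha b hb
  -- The inner end points of an arrow of the double pull-back are the images under `b` of the outer
  -- ones.
  φ_Φ r := PB.ext rfl (congrArg Λ.toFun (PB.ext (PB.ws r) rfl (PB.wt r).symm)) rfl
  Ψ z := FP.mk (FP.fst (FP.fst z)) (FP.snd z) ((FP.w (FP.fst z)).trans (congrArg a (FP.w z)))
  Ψinv z := FP.mk (FP.mk (FP.fst z) (b (FP.snd z)) (FP.w z)) (FP.snd z) rfl
  left_inv z := FP.ext (FP.ext rfl (FP.w z).symm) rfl
  right_inv _ := rfl
  smooth_Ψ := FP.contMDiff_iff.2 ⟨(FP.smooth_fst (hf := E.bun.hπ.subm) (hg := ha.smooth)).comp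
    (FP.smooth_fst (hf := ((E.pullback a ha).map Λ).bun.hπ.subm) (hg := hb.smooth)),
    FP.smooth_snd⟩
  smooth_Ψinv := FP.contMDiff_iff.2 ⟨FP.contMDiff_iff.2 ⟨FP.smooth_fst,
    hb.smooth.comp FP.smooth_snd⟩, FP.smooth_snd⟩
  π_Ψ _ := rfl
  Ψ_ract _ _ := rfl
  Ψ_lact _ _ _ := rfl
  χ_Ψ _ _ := rfl

/-- The isomorphism `E[a] ≅ E[b]`, up to identification of the base groupoids, induced by a smooth
family of arrows `γ x` from `a x` to `b x`. -/
noncomputable def conj (E : Extension C 𝒢) {a b : N → M} (ha : SurjSubm a) (hb : SurjSubm b)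
    {γ : N → E.ext.R.arr} (hs : ∀ x, E.ext.R.s (γ x) = a x) (ht : ∀ x, E.ext.R.t (γ x) = b x)
    (hγ : Smooth γ) {𝓗 : LieGroupoid N} (Λ : Iso (𝒢.pullback a ha) 𝓗)
    (Λ' : Iso (𝒢.pullback b hb) 𝓗)
    (h : ∀ z, Λ'.toFun (𝒢.conjFun (γ := fun x => E.ext.φ (γ x)) ha hb
      (fun x => (E.ext.mor.s_map _).trans (hs x)) (fun x => (E.ext.mor.t_map _).trans (ht x)) z) =
      Λ.toFun z) :
    ExtIso ((E.pullback a ha).map Λ) ((E.pullback b hb).map Λ') where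
  Φ := E.ext.R.conjIso ha hb hs ht hγ
  φ_Φ r := by
    refine Eq.trans ?_ (h _)
    exact congrArg Λ'.toFun (E.ext.R.conjFun_pullbackMap ha hb hs ht E.ext.mor _ _ r)
  -- An arrow carries the fibre over its target to the fibre over its source. Hence `γ⁻¹`, with
  -- target `a x` and source `b x`, moves a point over `a x` to one over `b x`.
  Ψ z := FP.mk (E.bun.lact (E.ext.R.inv (γ (FP.snd z))) (FP.fst z)
      ((E.ext.R.t_inv _).trans ((hs _).trans (FP.w z).symm))) (FP.snd z)
    ((E.bun.π_lact _ _ _).trans ((E.ext.R.s_inv _).trans (ht _)))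
  Ψinv z := FP.mk (E.bun.lact (γ (FP.snd z)) (FP.fst z) ((ht _).trans (FP.w z).symm)) (FP.snd z)
    ((E.bun.π_lact _ _ _).trans (hs _))
  left_inv z := FP.ext (E.bun.lact_lact_inv _ _ _ _) rfl
  right_inv z := FP.ext (E.bun.lact_inv_lact _ _ _ _) rfl
  smooth_Ψ := FP.contMDiff_iff.2 ⟨E.bun.smooth_lact_of_smooth
    (E.ext.R.smooth_inv.comp (hγ.comp FP.smooth_snd)) FP.smooth_fst _, FP.smooth_snd⟩
  smooth_Ψinv := FP.contMDiff_iff.2 ⟨E.bun.smooth_lact_of_smooth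
    (hγ.comp FP.smooth_snd) FP.smooth_fst _, FP.smooth_snd⟩
  π_Ψ _ := rfl
  Ψ_ract z k := FP.ext (E.bun.lact_ract _ _ _ _).symm rfl
  Ψ_lact r z k := FP.ext
    (E.bun.lact_lact_cancel_middle _ _ _ _ _ (congrArg γ k) _ _ _ _ _ _) rfl
  -- Equivariance of `χ` gives `χ(γ⁻¹ · p)(g) = γ⁻¹ χ(p)(g) (γ⁻¹)⁻¹`, which is the conjugate used
  -- for `Φ`.
  χ_Ψ z g := PB.ext rfl (by
    refine (E.χ_lact _ _ _ _).trans ?_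
    simp only [LieGroupoid.conj, inv_inv]
    rfl) rfl

end ExtIso

end LieGroupoid

/-! ### Surjective submersions needed for common refinements. -/

theorem Mfd.surjSubm_id (M : Mfd.{u}) : SurjSubm fun x : M => x :=
  ⟨subm_of_hasSec contMDiff_id fun _ => ⟨fun y => y, contMDiffAt_id, rfl,
    Eventually.of_forall fun _ => rfl⟩, Function.surjective_id⟩

/-- The base change `M' ×_P N → M ×_P N` of a surjective submersion `M' → M` is a surjective
submersion. -/
theorem FP.surjSubm_mapFst {M M' N P : Mfd.{u}} {q : M → P} {f : N → P} (hq : Subm q)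
    (hf : Smooth f) {p : M' → M} (hp : SurjSubm p) :
    SurjSubm (M := FP (fun x => q (p x)) f (hq.comp hp.subm) hf) (N := FP q f hq hf)
      fun z => FP.mk (p (FP.fst z)) (FP.snd z) (FP.w z) := by
  have l1 := FP.smooth_fst (hf := hq.comp hp.subm) (hg := hf)
  have l2 := FP.smooth_snd (hf := hq.comp hp.subm) (hg := hf)
  refine ⟨subm_of_hasSec (FP.contMDiff_iff.2 ⟨hp.smooth.comp l1, l2⟩) fun z => ?_, fun y => ?_⟩
  · obtain ⟨σ, h1, h2, h3⟩ := hp.subm.hasSec (FP.fst z)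
    set w : FP q f hq hf := FP.mk (p (FP.fst z)) (FP.snd z) (FP.w z) with hw
    have k1 := (FP.smooth_fst (hf := hq) (hg := hf)).contMDiffAt (x := w)
    have k2 := (FP.smooth_snd (hf := hq) (hg := hf)).contMDiffAt (x := w)
    have h3' : ∀ᶠ y : FP q f hq hf in 𝓝 w, p (σ (FP.fst y)) = FP.fst y :=
      k1.continuousAt.eventually h3
    -- The section is `(σ ∘ fst, snd)`; it lands in the fibre product only near `w`, where `σ` is a
    -- section of `p`.
    obtain ⟨c, c1, c2, c3, c4⟩ := FP.exists_lift (hf := hq.comp hp.subm) (hg := hf)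
      (X := FP q f hq hf) (a := fun y => σ (FP.fst y)) (b := FP.snd) (x := w)
      (ContMDiffAt.comp w h1 k1) k2
      (h3'.mono fun y hy => (congrArg q hy).trans (FP.w y))
    refine ⟨c, c1, FP.ext (c2.trans h2) c3, ?_⟩
    filter_upwards [c4, h3'] with y hy hy'
    exact FP.ext ((congrArg p hy.1).trans hy') hy.2
  · obtain ⟨x, hx⟩ := hp.surj (FP.fst y)
    exact ⟨FP.mk x (FP.snd y) ((congrArg q hx).trans (FP.w y)), FP.ext hx rfl⟩

/-! ### Conjugation and isomorphisms of groupoids. -/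

namespace LieGroupoid

variable {C : CrossedModule.{u}} {B₀ B₀' : Mfd.{u}} {B : LieGroupoid B₀} {B' : LieGroupoid B₀'}

theorem conj_one_one {M : Mfd.{u}} (R : LieGroupoid M) (m m' : M) (x : R.arr)
    (h : R.t (R.inv (R.one m)) = R.s x)
    (h' : R.t (R.mul (R.inv (R.one m)) x h) = R.s (R.one m')) :
    R.mul (R.mul (R.inv (R.one m)) x h) (R.one m') h' = x := by
  have e : R.inv (R.one m) = R.one m :=
    (R.eq_inv_of_mul_eq_one _ _ ((R.t_one m).trans (R.s_one m).symm)
      (by rw [one_mul_of_comp, R.s_one])).symm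
  simp only [e, one_mul_of_comp, mul_one_of_comp]

/-- `Θ⁻¹` is a morphism and cancels `Θ` on the middle factor. The case `Θ = Φ`, with `u` and `v`
having unit middle components, produces the link arrows. -/
theorem Iso.invFun_conj {M : Mfd.{u}} {R S : LieGroupoid M} (Θ : Iso R S) (u : S.arr) (r : R.arr)
    (v : S.arr) (h : S.s u = S.s (Θ.toFun r)) (h' : S.t (Θ.toFun r) = S.s v) :
    Θ.invFun (S.mul (S.mul (S.inv u) (Θ.toFun r) ((S.t_inv u).trans h)) v
        ((S.t_mul _ _ _).trans h')) =
      R.mul (R.mul (R.inv (Θ.invFun u)) r ((R.t_inv _).trans ((Θ.mor_inv.s_map u).trans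
        (h.trans (Θ.mor.s_map r))))) (Θ.invFun v) ((R.t_mul _ _ _).trans
          ((Θ.mor.t_map r).symm.trans (h'.trans (Θ.mor_inv.s_map v).symm))) := by
  simp only [Θ.mor_inv.map_mul, Θ.mor_inv.map_inv, Θ.left_inv]

/-! ### Reduction to a single pull-back, `(E.pullback a ha).map Λ`. -/

namespace ExtIso

variable {M N K : Mfd.{u}} {𝒢 : LieGroupoid M} {𝓗 𝓗' : LieGroupoid N} {E : Extension C 𝒢}
  {a : N → M} {ha : SurjSubm a} {X : Extension C 𝓗} {Λ : Iso (𝒢.pullback a ha) 𝓗}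

/-- Transport of an isomorphism with a transported pull-back. -/
noncomputable def mapTrans (I : ExtIso X ((E.pullback a ha).map Λ)) (Θ : Iso 𝓗 𝓗') :
    ExtIso (X.map Θ) ((E.pullback a ha).map (Λ.trans Θ)) :=
  I.map Θ

/-- Pull-back of an isomorphism with a transported pull-back. -/
noncomputable def pullbackTrans (I : ExtIso X ((E.pullback a ha).map Λ)) (b : K → N)
    (hb : SurjSubm b) : ExtIso (X.pullback b hb) ((E.pullback (fun x => a (b x)) (ha.comp hb)).map
      ((pullbackComp 𝒢 a ha b hb).symm.trans (Λ.pullback b hb))) :=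
  (I.pullback b hb).trans (pullbackMapPullback E a ha Λ b hb)

/-- The identity, as an isomorphism between pull-backs along equal maps. -/
noncomputable def pullbackCongr (E : Extension C 𝒢) {a a' : N → M} {ha : SurjSubm a}
    {ha' : SurjSubm a'} (e : ∀ x, a x = a' x) (Λ : Iso (𝒢.pullback a ha) 𝓗)
    (Λ' : Iso (𝒢.pullback a' ha') 𝓗)
    (h : ∀ z, Λ'.toFun ((LieGroupoid.pullbackCongr 𝒢 ha ha' e).toFun z) = Λ.toFun z) :
    ExtIso ((E.pullback a ha).map Λ) ((E.pullback a' ha').map Λ') := by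
  -- Once the maps are identified, `LieGroupoid.pullbackCongr` is the identity on arrows and `h`
  -- compares `Λ'` with `Λ` directly.
  obtain rfl : a = a' := funext e
  exact mapCongr _ h

end ExtIso

/-- Isomorphisms over the identity preserve end points, so only the middle components, arrows of
`B`, have to be compared. -/
theorem Iso.toFun_eq_toFun {M : Mfd.{u}} {R R' : LieGroupoid M} {q : M → B₀} {hq : SurjSubm q}
    (Θ : Iso R (B.pullback q hq)) (Θ' : Iso R' (B.pullback q hq)) {r : R.arr} {r' : R'.arr}
    (hs : R.s r = R'.s r') (ht : R.t r = R'.t r')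
    (h : PB.mid (Θ.toFun r) = PB.mid (Θ'.toFun r')) : Θ.toFun r = Θ'.toFun r' :=
  PB.ext ((Θ.mor.s_map r).trans (hs.trans (Θ'.mor.s_map r').symm)) h
    ((Θ.mor.t_map r).trans (ht.trans (Θ'.mor.t_map r').symm))

/-! ### Link arrows: points of `T` in the same fibre of `g`, joined in `B[f]`. -/

namespace MoritaEquiv

variable (𝓜 : MoritaEquiv B B')

/-- The arrow of `B[f]` from `x` to `y` which corresponds under `Φ` to the unit arrow of `B'`
at `g x = g y`. -/
noncomputable def link (x y : 𝓜.T) (h : 𝓜.g x = 𝓜.g y) : (B.pullback 𝓜.f 𝓜.hf).arr :=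
  𝓜.Φ.invFun (PB.mk x (B'.one (𝓜.g x)) y (B'.s_one _).symm ((B'.t_one _).trans h))

theorem src_link (x y : 𝓜.T) (h : 𝓜.g x = 𝓜.g y) : PB.src (𝓜.link x y h) = x :=
  𝓜.Φ.mor_inv.s_map _

theorem tgt_link (x y : 𝓜.T) (h : 𝓜.g x = 𝓜.g y) : PB.tgt (𝓜.link x y h) = y :=
  𝓜.Φ.mor_inv.t_map _

theorem smooth_link {X : Mfd.{u}} {a b : X → 𝓜.T} (ha : Smooth a) (hb : Smooth b)
    (h : ∀ x, 𝓜.g (a x) = 𝓜.g (b x)) : Smooth fun x => 𝓜.link (a x) (b x) (h x) :=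
  𝓜.Φ.mor_inv.smooth.comp (PB.contMDiff 𝓜.hg ha
    (B'.smooth_one.comp (𝓜.hg.smooth.comp ha)) hb)

/-- Moving the end points of an arrow of `B'[g]` within the fibres of `g` amounts to conjugation
with `link` on the side of `B[f]`. -/
theorem invFun_mk_eq_conj {x x' y y' : 𝓜.T} (hx : 𝓜.g x = 𝓜.g x') (hy : 𝓜.g y = 𝓜.g y')
    (r : (B.pullback 𝓜.f 𝓜.hf).arr) (hr : PB.src r = x) (hr' : PB.tgt r = y) (b : B'.arr)
    (hb : PB.mid (𝓜.Φ.toFun r) = b) (h1 : 𝓜.g x' = B'.s b) (h2 : B'.t b = 𝓜.g y') :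
    𝓜.Φ.invFun (PB.mk x' b y' h1 h2) = (B.pullback 𝓜.f 𝓜.hf).mul
      ((B.pullback 𝓜.f 𝓜.hf).mul ((B.pullback 𝓜.f 𝓜.hf).inv (𝓜.link x x' hx)) r
        (((B.pullback 𝓜.f 𝓜.hf).t_inv _).trans ((𝓜.src_link _ _ _).trans hr.symm)))
      (𝓜.link y y' hy) (((B.pullback 𝓜.f 𝓜.hf).t_mul _ _ _).trans
        (hr'.trans (𝓜.src_link _ _ _).symm)) := by
  subst hr hr' hb
  have e := 𝓜.Φ.invFun_conj
    (PB.mk (PB.src r) (B'.one (𝓜.g (PB.src r))) x' (B'.s_one _).symm ((B'.t_one _).trans hx)) r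
    (PB.mk (PB.tgt r) (B'.one (𝓜.g (PB.tgt r))) y' (B'.s_one _).symm ((B'.t_one _).trans hy))
    (𝓜.Φ.mor.s_map r).symm (𝓜.Φ.mor.t_map r)
  -- In `B'[g]` the arrow `(x', b, y')` equals `(x, 1, x')⁻¹ (x, b, y) (y, 1, y')`, where `(x, b, y)
  -- = Φ r`.
  refine Eq.trans (congrArg 𝓜.Φ.invFun ?_) e
  exact PB.ext rfl (B'.conj_one_one _ _ _ _ _).symm rfl

end MoritaEquiv

/-! ### Transport respects Morita equivalence. -/

/-- Transport maps isomorphic extensions with the same base map to Morita equivalent extensions. -/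
theorem MoritaEquiv.moritaEq_transport (𝓜 : MoritaEquiv B B') {M : Mfd.{u}} {q q' : M → B₀}
    {hq : SurjSubm q} {hq' : SurjSubm q'} (h : ∀ x, q x = q' x)
    {E : Extension C (B.pullback q hq)} {E' : Extension C (B.pullback q' hq')}
    (I : ExtIso (E.map (pullbackCongr B hq hq' h)) E') :
    MoritaEq (𝓜.transport ⟨M, q, hq, E⟩) (𝓜.transport ⟨M, q', hq', E'⟩) := by
  obtain rfl : q = q' := funext h
  refine ⟨𝓜.base q hq, fun x => x, fun x => x, surjSubm_id _, surjSubm_id _, fun _ => rfl, ⟨?_⟩⟩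
  -- For equal base maps `pullbackCongr` is the identity on arrows, so `I` is an isomorphism from
  -- `E` itself.
  have J : ExtIso E E' := (ExtIso.mapCongr (Θ := Iso.refl _) E fun _ => rfl).trans I
  have K := (((J.pullback (𝓜.α q hq) (𝓜.surjSubm_α q hq)).map (𝓜.baseIso q hq)).pullback
    (fun x => x) (surjSubm_id _)).map
      (pullbackComp B' _ (𝓜.hg.comp (𝓜.surjSubm_β q hq)) (fun x => x) (surjSubm_id _))
  exact ExtIso.trans (ExtIso.mapCongr (Θ := Iso.refl _) _ fun _ => rfl) K

/-- The transport of a pull-back is Morita equivalent to the transport. -/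
theorem MoritaEquiv.moritaEq_transport_pullback (𝓜 : MoritaEquiv B B') (E : ExtOver C B)
    {M' : Mfd.{u}} (p : M' → E.M) (hp : SurjSubm p) :
    MoritaEq (𝓜.transport E) (𝓜.transport (E.pullback p hp)) := by
  refine ⟨𝓜.base (fun x => E.q (p x)) (E.hq.comp hp),
    fun z : FPSet _ _ => FP.mk (p (FP.fst z)) (FP.snd z) (FP.w z), fun x => x,
    FP.surjSubm_mapFst E.hq.subm 𝓜.hf.smooth hp, surjSubm_id _, fun _ => rfl, ⟨?_⟩⟩
  -- `I1` and `I2` reduce the two sides to single pull-backs of `E.ext` along the same map `(x, t) ↦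
  -- p x`; only the identifications of the base groupoids are left to compare.
  have I1 := (((ExtIso.refl ((E.ext.pullback (𝓜.α E.q E.hq) (𝓜.surjSubm_α E.q E.hq)).map
    (𝓜.baseIso E.q E.hq))).pullbackTrans _ (FP.surjSubm_mapFst E.hq.subm 𝓜.hf.smooth hp)).mapTrans
    (pullbackComp B' _ (𝓜.transport E).hq _ _)).mapTrans
      (pullbackCongr B' _ ((𝓜.transport (E.pullback p hp)).hq.comp (surjSubm_id _)) fun _ => rfl)
  have I2 := (((((ExtIso.refl ((E.ext.pullback p hp).map (pullbackComp B E.q E.hq p hp))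
    ).pullbackTrans (𝓜.α _ (E.hq.comp hp)) (𝓜.surjSubm_α _ _)).mapTrans
      (𝓜.baseIso _ (E.hq.comp hp))).pullbackTrans (fun x => x) (surjSubm_id _))).mapTrans
    (pullbackComp B' _ (𝓜.transport (E.pullback p hp)).hq _ _)
  refine I1.trans (ExtIso.trans ?_ I2.symm)
  refine ExtIso.pullbackCongr E.ext (fun _ => rfl) _ _ fun z => ?_
  have h1 : 𝓜.f (FP.snd (PB.src z)) = B.s (PB.mid (PB.mid z)) :=
    (FP.w (PB.src z)).symm.trans ((congrArg E.q (PB.ws z)).trans (PB.ws (PB.mid z)))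
  have h2 : B.t (PB.mid (PB.mid z)) = 𝓜.f (FP.snd (PB.tgt z)) :=
    (PB.wt (PB.mid z)).trans ((congrArg E.q (PB.wt z)).trans (FP.w (PB.tgt z)))
  refine Iso.toFun_eq_toFun _ _ rfl rfl ?_
  -- Both identifications keep the arrow `b` of `B` and apply `Φ` to `(β x, b, β y)`.
  trans PB.mid (𝓜.Φ.toFun (PB.mk (FP.snd (PB.src z)) (PB.mid (PB.mid z)) (FP.snd (PB.tgt z)) h1 h2))
  · rfl
  · rfl

/-! ### Transport along `𝓜` followed by `𝓜.symm`. -/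

/-- Transport along a Morita equivalence and its inverse gives a Morita equivalent extension. -/
theorem MoritaEquiv.moritaEq_symm_transport_transport (𝓜 : MoritaEquiv B B') (E : ExtOver C B) :
    MoritaEq (𝓜.symm.transport (𝓜.transport E)) E := by
  let bT := (𝓜.transport E).q
  have hbT : SurjSubm bT := (𝓜.transport E).hq
  -- `Y` consists of the pairs of points of `M ×_{B₀} T ×_{B₀'} T` and `M` with the same image
  let Z := 𝓜.symm.base bT hbT
  let z1 : Z → 𝓜.base E.q E.hq := 𝓜.symm.α bT hbT
  let z2 : Z → 𝓜.T := 𝓜.symm.β bT hbT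
  have hz1 : SurjSubm z1 := 𝓜.symm.surjSubm_α bT hbT
  have hz2 : SurjSubm z2 := 𝓜.symm.surjSubm_β bT hbT
  let fz : Z → B₀ := fun z => 𝓜.f (z2 z)
  have hfz : SurjSubm fz := 𝓜.hf.comp hz2
  let Y := FP fz E.q hfz.subm E.hq.smooth
  let y1 : Y → Z := FP.fst
  let y2 : Y → E.M := FP.snd
  have hy1 : SurjSubm y1 := FP.surjSubm_fst hfz.subm E.hq
  have hy2 : SurjSubm y2 := FP.surjSubm_snd hfz E.hq.smooth
  let m : Y → E.M := fun y => 𝓜.α E.q E.hq (z1 (y1 y))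
  let t : Y → 𝓜.T := fun y => 𝓜.β E.q E.hq (z1 (y1 y))
  let t' : Y → 𝓜.T := fun y => z2 (y1 y)
  have hm : SurjSubm m := (𝓜.surjSubm_α E.q E.hq).comp (hz1.comp hy1)
  have ht : SurjSubm t := (𝓜.surjSubm_β E.q E.hq).comp (hz1.comp hy1)
  have ht' : SurjSubm t' := hz2.comp hy1
  have e1 : ∀ y, E.q (m y) = 𝓜.f (t y) := fun y => FP.w (z1 (y1 y))
  have e2 : ∀ y, 𝓜.g (t y) = 𝓜.g (t' y) := fun y => FP.w (y1 y)
  have e3 : ∀ y, 𝓜.f (t' y) = E.q (y2 y) := fun y => FP.w y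
  let k : Y → (B.pullback 𝓜.f 𝓜.hf).arr := fun y => 𝓜.link (t y) (t' y) (e2 y)
  have hk : Smooth k := 𝓜.smooth_link ht.smooth ht'.smooth e2
  -- The middle component of the link arrow runs from `f (t y) = q (m y)` to `f (t' y) = q (y2 y)`,
  -- so it defines an arrow of `B[q]` between the two points of `M`.
  let c : Y → (B.pullback E.q E.hq).arr := fun y => PB.mk (m y) (PB.mid (k y)) (y2 y)
    ((e1 y).trans ((congrArg 𝓜.f (𝓜.src_link _ _ _)).symm.trans (PB.ws (k y))))
    ((PB.wt (k y)).trans ((congrArg 𝓜.f (𝓜.tgt_link _ _ _)).trans (e3 y)))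
  have hc : Smooth c := PB.contMDiff E.hq hm.smooth ((PB.smooth_mid 𝓜.hf).comp hk) hy2.smooth
  -- `W` consists of the pairs `(r, y)` with `φ r = c y`. Its first projection `γ` is a smooth lift
  -- of `c`, which need not exist over `Y`; its second is a surjective submersion because `φ` is.
  let W := FP E.ext.ext.φ c E.ext.ext.surjSubm.subm hc
  let γ : W → E.ext.ext.R.arr := FP.fst
  let w : W → Y := FP.snd
  have hγ : Smooth γ := FP.smooth_fst
  have hw : SurjSubm w := FP.surjSubm_snd E.ext.ext.surjSubm hc
  have eγ : ∀ x, E.ext.ext.φ (γ x) = c (w x) := fun x => FP.w x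
  have hγs : ∀ x, E.ext.ext.R.s (γ x) = m (w x) := fun x =>
    (E.ext.ext.mor.s_map _).symm.trans (congrArg PB.src (eγ x))
  have hγt : ∀ x, E.ext.ext.R.t (γ x) = y2 (w x) := fun x =>
    (E.ext.ext.mor.t_map _).symm.trans (congrArg PB.tgt (eγ x))
  refine ⟨W, fun x => y1 (w x), fun x => y2 (w x), hy1.comp hw, hy2.comp hw,
    fun x => e3 (w x), ⟨?_⟩⟩
  -- Over `W`, the double transport becomes the pull-back of `E.ext` along `m ∘ w`, with all the
  -- identifications of groupoids composed into one.
  have I := ((((((ExtIso.refl ((E.ext.pullback (𝓜.α E.q E.hq) (𝓜.surjSubm_α E.q E.hq)).map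
    (𝓜.baseIso E.q E.hq))).pullbackTrans z1 hz1).mapTrans
    (𝓜.symm.baseIso bT hbT))).pullbackTrans (fun x => y1 (w x)) (hy1.comp hw)).mapTrans
    (pullbackComp B _ (𝓜.symm.transport (𝓜.transport E)).hq _ _)).mapTrans
      (pullbackCongr B _ (E.hq.comp (hy2.comp hw)) fun x => e3 (w x))
  refine I.trans ?_
  -- Conjugation by `γ` passes from `m ∘ w` to `y2 ∘ w`. What remains is an identity in the base
  -- groupoid: conjugation by `φ ∘ γ` has the effect of the composed identification.
  refine ExtIso.conj E.ext (hm.comp hw) (hy2.comp hw) hγs hγt hγ _ _ fun z => ?_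
  refine Iso.toFun_eq_toFun _ _ rfl rfl ?_
  have h1 : 𝓜.f (t (w (PB.src z))) = B.s (PB.mid (PB.mid z)) :=
    (e1 _).symm.trans ((congrArg E.q (PB.ws z)).trans (PB.ws (PB.mid z)))
  have h2 : B.t (PB.mid (PB.mid z)) = 𝓜.f (t (w (PB.tgt z))) :=
    (PB.wt (PB.mid z)).trans ((congrArg E.q (PB.wt z)).trans (e1 _))
  -- The composed identification sends `r` to `Φ r`, moves its end points from `t` to `t'`, and
  -- applies `Φ⁻¹`; by `invFun_mk_eq_conj` this is conjugation of `r` by link arrows.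
  let r : (B.pullback 𝓜.f 𝓜.hf).arr :=
    PB.mk (t (w (PB.src z))) (PB.mid (PB.mid z)) (t (w (PB.tgt z))) h1 h2
  have h3 : 𝓜.g (t' (w (PB.src z))) = B'.s (PB.mid (𝓜.Φ.toFun r)) :=
    (e2 _).symm.trans ((congrArg 𝓜.g (𝓜.Φ.mor.s_map r)).symm.trans (PB.ws _))
  have h4 : B'.t (PB.mid (𝓜.Φ.toFun r)) = 𝓜.g (t' (w (PB.tgt z))) :=
    (PB.wt _).trans ((congrArg 𝓜.g (𝓜.Φ.mor.t_map r)).trans (e2 _))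
  have key := congrArg PB.mid (𝓜.invFun_mk_eq_conj (e2 (w (PB.src z))) (e2 (w (PB.tgt z))) r rfl rfl
    _ rfl h3 h4)
  refine Eq.trans ?_ (key.symm.trans ?_)
  -- After replacing `φ ∘ γ` by `c ∘ w`, the conjugating arrows of `B` are the middle components of
  -- the link arrows.
  · exact congrArg (fun v => PB.mid (PB.mid v)) ((B.pullback E.q E.hq).conjFun_congr (hm.comp hw)
      (hy2.comp hw) (fun x => congrArg PB.src (eγ x)) (fun x => congrArg PB.tgt (eγ x))
      (fun _ => rfl) (fun _ => rfl) eγ z)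
  · rfl

/-! ### The induced map on gerbes and its inverse. -/

theorem MoritaEquiv.gerbe_transport_eq (𝓜 : MoritaEquiv B B') {E E' : ExtOver C B}
    (h : MoritaEq E E') : Gerbe.mk (𝓜.transport E) = Gerbe.mk (𝓜.transport E') := by
  obtain ⟨M'', p, p', hp, hp', h, ⟨I⟩⟩ := h
  -- The chain passes through the transports of the two pull-backs. It is composed as equalities in
  -- the quotient, so transitivity of `MoritaEq` itself is not needed.
  exact (Quot.sound (𝓜.moritaEq_transport_pullback E p hp)).trans
    ((Quot.sound (𝓜.moritaEq_transport h I)).trans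
      (Quot.sound (𝓜.moritaEq_transport_pullback E' p' hp')).symm)

/-- The map on gerbes induced by a Morita equivalence. -/
noncomputable def MoritaEquiv.gerbeMap (𝓜 : MoritaEquiv B B') : Gerbe C B → Gerbe C B' :=
  Quot.lift (fun E => Gerbe.mk (𝓜.transport E)) fun _ _ => 𝓜.gerbe_transport_eq

theorem MoritaEquiv.gerbeMap_symm_gerbeMap (𝓜 : MoritaEquiv B B') (x : Gerbe C B) :
    𝓜.symm.gerbeMap (𝓜.gerbeMap x) = x :=
  Quot.inductionOn x fun E => Quot.sound (𝓜.moritaEq_symm_transport_transport E)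

end LieGroupoid

theorem mainTheorem7 {B₀ B₀' : Mfd.{u}} (C : CrossedModule.{u}) (B : LieGroupoid B₀)
    (B' : LieGroupoid B₀') (𝓜 : LieGroupoid.MoritaEquiv B B') :
    ∃ F : LieGroupoid.Gerbe C B ≃ LieGroupoid.Gerbe C B',
      (∀ E : LieGroupoid.ExtOver C B,
        F (LieGroupoid.Gerbe.mk E) = LieGroupoid.Gerbe.mk (𝓜.transport E)) ∧
      (∀ E' : LieGroupoid.ExtOver C B',
        F.symm (LieGroupoid.Gerbe.mk E') = LieGroupoid.Gerbe.mk (𝓜.symm.transport E')) := by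
  -- `𝓜.symm.symm` is `𝓜` by definition, so the same lemma for `𝓜.symm` gives the other inverse law.
  exact ⟨⟨𝓜.gerbeMap, 𝓜.symm.gerbeMap, 𝓜.gerbeMap_symm_gerbeMap,
    𝓜.symm.gerbeMap_symm_gerbeMap⟩, fun _ => rfl, fun _ => rfl⟩
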